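/- **Computability models.** Let $\mathsf c:\mathbb N^2\to\mathbb N$ be a bijection with inverse functions $\mathsf p_1,\mathsf p_2$ (so $\mathsf p_i(\mathsf c(a_1,a_2))=a_i$). Let $V=\bigcup_{n\ge 0}V_n$ be a set of partial functions on $\mathbb N$, $V_n$ being its $n$-ary members ("$V$-functions"), and for every $n$ let a numbering of $V_n$ be fixed: an index set $\mathsf I_n\subseteq\mathbb N$ and a map $e\mapsto\varphi^n_e$ of $\mathsf I_n$ onto $V_n$. We write $!t$ for "$t$ is defined" and $\simeq$ for "both sides undefined, or both defined and equal". $V$ is a *basic computability model* if * (BF) all projections $(a_1,\dots,a_n)\mapsto a_i$ and $\mathsf c,\mathsf p_1,\mathsf p_2$ are $V$-functions; * (Cm) for all $n,m_1,\dots,m_n$, with $m=\max_i m_i$ ($m=0$ if $n=0$), there is an $(n+1)$-ary $V$-function $s$ such that for all $e\in\mathsf I_n$, $e_i\in\mathsf I_{m_i}$: $s(e,e_1,\dots,e_n)\in\mathsf I_m$ and $\varphi_{s(e,e_1,\dots,e_n)}(x_1,\dots,x_m)\simeq\varphi_e(\varphi_{e_1}(x_1,\dots,x_{m_1}),\dots,\varphi_{e_n}(x_1,\dots,x_{m_n}))$;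 * (Cn) there is a unary $V$-function $s$ with $s(k)\in\mathsf I_0$ and $\varphi^0_{s(k)}\simeq k$ for all $k$; * (Cs) for every $n$ there is a binary $V$-function $s$ such that for all $e_1,e_2\in\mathsf I_n$: $s(e_1,e_2)\in\mathsf I_{n+1}$ and $\varphi_{s(e_1,e_2)}(x_1,\dots,x_n,d)$ is $\simeq\varphi_{e_1}(x_1,\dots,x_n)$ if $d=0$ and $\simeq\varphi_{e_2}(x_1,\dots,x_n)$ if $d\ne0$. A binary partial function $\mathsf u$ is *overuniversal for the unary $V$-functions* if $!\mathsf u(e,a)$ and $\mathsf u(e,a)=\varphi_e(a)$ whenever $e\in\mathsf I_1$ and $!\varphi_e(a)$. **Formulas and realizability.** Formulas are those of first-order predicate logic without constants, function symbols and equality, with countably many predicate symbols of each arity, built with $\bot,\top,\land,\lor,\to,\forall,\exists$. For $\varnothing\ne M\subseteq\mathbb N$, an $M$-evaluation $f$ assigns to every $n$-ary predicate symbol $P$ a function $P^f:M^n\to 2^{\mathbb N}$. The relation $e\mathrel{\mathbf r_f}A$, for sentences $A$ with constants from $M$, is defined by: never $e\mathrel{\mathbf r_f}\bot$; always $e\mathrel{\mathbf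 r_f}\top$; $e\mathrel{\mathbf r_f}P(\bar a)$ iff $e\in P^f(\bar a)$; $e\mathrel{\mathbf r_f}\Phi\land\Psi$ iff $\mathsf p_1e\mathrel{\mathbf r_f}\Phi$ and $\mathsf p_2e\mathrel{\mathbf r_f}\Psi$; $e\mathrel{\mathbf r_f}\Phi\lor\Psi$ iff ($\mathsf p_1e=0$ and $\mathsf p_2e\mathrel{\mathbf r_f}\Phi$) or ($\mathsf p_1e=1$ and $\mathsf p_2e\mathrel{\mathbf r_f}\Psi$); $e\mathrel{\mathbf r_f}\exists x\,\Phi(x)$ iff $\mathsf p_1e\in M$ and $\mathsf p_2e\mathrel{\mathbf r_f}\Phi(\mathsf p_1e)$; $e\mathrel{\mathbf r_f}\forall x_1\dots\forall x_n(\Phi\to\Psi)$, $n\ge0$, iff $e\in\mathsf I_{n+1}$ and for all $s\in\mathbb N$, $\bar a\in M^n$ with $s\mathrel{\mathbf r_f}\Phi(\bar a)$ we have $!\varphi_e(\bar a,s)$ and $\varphi_e(\bar a,s)\mathrel{\mathbf r_f}\Psi(\bar a)$; and, for $n\ge1$ and $\Psi$ neither an implication nor a universal formula, $e\mathrel{\mathbf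 r_f}\forall x_1\dots\forall x_n\Psi$ iff $e\mathrel{\mathbf r_f}\forall x_1\dots\forall x_n(\top\to\Psi)$. A sentence $A$ is *absolutely $V$-realizable over all domains* if there is one number $e$ such that $e\mathrel{\mathbf r_f}A$ for all nonempty $M\subseteq\mathbb N$ and all $M$-evaluations $f$. **Calculi.** IPC is the usual Hilbert-style intuitionistic predicate calculus. The language of Basic Predicate Calculus (BQC) consists of the formulas in which $\forall$ occurs only in the form $\forall\bar x(A\to B)$ ($\bar x$ a finite list of variables; $A\to B$ is the case of the empty list). BQC derives sequents $A\Rightarrow B$ of such formulas. Its axioms are $A\Rightarrow A$; $A\Rightarrow\top$; $\bot\Rightarrow A$; $A\land\exists xB\Rightarrow\exists x(A\land B)$ ($x$ not free in $A$); $A\land(B\lor C)\Rightarrow(A\land B)\lor(A\land C)$; $\forall\bar x(A\to B)\land\forall\bar x(B\to C)\Rightarrow\forall\bar x(A\to C)$; $\forall\bar x(A\to B)\land\forall\bar x(A\to C)\Rightarrow\forall\bar x(A\to B\land C)$; $\forall\bar x(B\to A)\land\forall\bar x(C\to A)\Rightarrow\forall\bar x(B\lor C\to A)$; $\forall\bar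 x(A\to B)\Rightarrow\forall\bar x([\bar t/\bar x]A\to[\bar t/\bar x]B)$; $\forall\bar x(A\to B)\Rightarrow\forall\bar y(A\to B)$ (no variable of $\bar y$ free in $\forall\bar x(A\to B)$); $\forall\bar x\,x(B\to A)\Rightarrow\forall\bar x(\exists xB\to A)$ ($x$ not free in $A$). Its rules are: from $A\Rightarrow B$ and $B\Rightarrow C$ infer $A\Rightarrow C$; from $A\Rightarrow B$ and $A\Rightarrow C$ infer $A\Rightarrow B\land C$, and conversely; from $B\Rightarrow A$ and $C\Rightarrow A$ infer $B\lor C\Rightarrow A$, and conversely; from $A\Rightarrow B$ infer $[t/x]A\Rightarrow[t/x]B$; from $B\Rightarrow A$ infer $\exists xB\Rightarrow A$, and conversely ($x$ not free in $A$); from $A\land B\Rightarrow C$ infer $A\Rightarrow\forall\bar x(B\to C)$ (no variable of $\bar x$ free in $A$). (Substituted terms, which are variables, must not become bound.) **Theorem.** Let $V$ be a basic computability model such that no $V$-function is overuniversal for the unary $V$-functions. Then: 1. BQC is sound for absolute $V$-realizability over all domains: if BQC derives $A\Rightarrow B$ and $\bar z=z_1,\dots,z_m$, $m\ge1$, is a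 list of distinct variables containing all free variables of $A$ and $B$, then the sentence $\forall\bar z\,(A\to B)$ is absolutely $V$-realizable over all domains. 2. IPC is not sound for absolute $V$-realizability over all domains in the same sense: there are a formula $A$ derivable in IPC and a list $\bar z=z_1,\dots,z_m$, $m\ge1$, of distinct variables containing all free variables of $A$ such that the (IPC-derivable) sentence $\forall\bar z\,A$ is not absolutely $V$-realizable over all domains. -/

import Mathlib

namespace VReal

/-! ### Partial functions, numberings, computability models -/

/-- `n`-ary partial functions on the natural numbers. -/
abbrev PartialFn (n : ℕ) : Type := (Fin n → ℕ) →. ℕ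

/-- Simultaneous (strict) evaluation of a finite family of partial values: it is defined
iff all of them are. -/
def evalAll {n : ℕ} (g : Fin n → Part ℕ) : Part (Fin n → ℕ) :=
  ⟨∀ i, (g i).Dom, fun h i => (g i).get (h i)⟩

/-- A set `V` of partial functions (`V n` being the set of its `n`-ary members) with, for every
arity `n`, a numbering `e ↦ φ n e` of `V n` by an index set `I n ⊆ ℕ`, together with a bijection
`c` of `ℕ²` to `ℕ`. The values `φ n e` with `e ∉ I n` carry no information. -/
structure NumberedFunctions where
  c : ℕ × ℕ ≃ ℕ
  V : (n : ℕ) → Set (PartialFn n)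
  I : ℕ → Set ℕ
  φ : (n : ℕ) → ℕ → PartialFn n
  numbering : ∀ n, φ n '' I n = V n

namespace NumberedFunctions

variable (W : NumberedFunctions)

/-- The inverse functions of the pairing `c`. -/
def p₁ (e : ℕ) : ℕ := (W.c.symm e).1

/-- See `p₁`. -/
def p₂ (e : ℕ) : ℕ := (W.c.symm e).2

/-- (BF): projections, pairing and unpairing are `V`-functions. -/
def BF : Prop :=
  (∀ (n : ℕ) (i : Fin n), (fun x => Part.some (x i) : PartialFn n) ∈ W.V n) ∧
  (fun x => Part.some (W.c (x 0, x 1)) : PartialFn 2) ∈ W.V 2 ∧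
  (fun x => Part.some (W.p₁ (x 0)) : PartialFn 1) ∈ W.V 1 ∧
  (fun x => Part.some (W.p₂ (x 0)) : PartialFn 1) ∈ W.V 1

/-- (Cm): the composition `φ_e(φ_{e₁}(x₁,…,x_{m₁}),…,φ_{eₙ}(x₁,…,x_{mₙ}))`, of arity
`m = max mᵢ`, is a `V`-function, with an index computed by a `V`-function. -/
def Cm : Prop :=
  ∀ (n : ℕ) (ms : Fin n → ℕ), ∃ s ∈ W.V (n + 1),
    ∀ e ∈ W.I n, ∀ es : Fin n → ℕ, (∀ i, es i ∈ W.I (ms i)) →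
      ∃ k ∈ s (Fin.cons e es), k ∈ W.I (Finset.univ.sup ms) ∧
        ∀ x : Fin (Finset.univ.sup ms) → ℕ,
          W.φ (Finset.univ.sup ms) k x =
            (evalAll fun i => W.φ (ms i) (es i)
              fun j => x (Fin.castLE (Finset.le_sup (Finset.mem_univ i)) j)).bind (W.φ n e)

/-- (Cn): constants are `V`-functions, with an index computed by a `V`-function. -/
def Cn : Prop :=
  ∃ s ∈ W.V 1, ∀ k : ℕ, ∃ j ∈ s ![k], j ∈ W.I 0 ∧ W.φ 0 j ![] = Part.some k

/-- (Cs): definition by cases, with an index computed by a `V`-function. -/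
def Cs : Prop :=
  ∀ n : ℕ, ∃ s ∈ W.V 2, ∀ e₁ ∈ W.I n, ∀ e₂ ∈ W.I n,
    ∃ j ∈ s ![e₁, e₂], j ∈ W.I (n + 1) ∧ ∀ (x : Fin n → ℕ) (d : ℕ),
      W.φ (n + 1) j (Fin.snoc (α := fun _ => ℕ) x d) =
        if d = 0 then W.φ n e₁ x else W.φ n e₂ x

/-- Basic computability models. -/
def IsBasicModel : Prop := W.BF ∧ W.Cm ∧ W.Cn ∧ W.Cs

/-- `u` is overuniversal for the `n`-ary `V`-functions: `u(e, a₁,…,aₙ)` is defined and equal to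
`φ_e(a₁,…,aₙ)` whenever `e ∈ I n` and the latter is defined. -/
def Overuniversal (n : ℕ) (u : PartialFn (n + 1)) : Prop :=
  ∀ e ∈ W.I n, ∀ (a : Fin n → ℕ), ∀ k ∈ W.φ n e a, k ∈ u (Fin.cons e a)

end NumberedFunctions

/-! ### Predicate formulas -/

/-- Formulas of predicate logic without constants, function symbols and equality. The variables
are the natural numbers; `atom n i t` is `Pᵢⁿ(t₁,…,tₙ)`, where `Pᵢⁿ` is the `i`-th
predicate symbol of arity `n`. -/
inductive Formula : Type
  | bot : Formula
  | top : Formula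
  | atom (n : ℕ) (i : ℕ) (t : Fin n → ℕ) : Formula
  | conj : Formula → Formula → Formula
  | disj : Formula → Formula → Formula
  | imp : Formula → Formula → Formula
  | all : ℕ → Formula → Formula
  | ex : ℕ → Formula → Formula

namespace Formula

/-- The free variables of a formula. -/
def fv : Formula → Finset ℕ
  | bot => ∅
  | top => ∅
  | atom _ _ t => Finset.univ.image t
  | conj A B => A.fv ∪ B.fv
  | disj A B => A.fv ∪ B.fv
  | imp A B => A.fv ∪ B.fv
  | all x A => A.fv.erase x
  | ex x A => A.fv.erase x

/-- Simultaneous replacement of every free occurrence of every variable `y` by the term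
(that is, variable) `θ y`. -/
def subst : Formula → (ℕ → ℕ) → Formula
  | bot, _ => bot
  | top, _ => top
  | atom n i t, θ => atom n i (θ ∘ t)
  | conj A B, θ => conj (A.subst θ) (B.subst θ)
  | disj A B, θ => disj (A.subst θ) (B.subst θ)
  | imp A B, θ => imp (A.subst θ) (B.subst θ)
  | all x A, θ => all x (A.subst (Function.update θ x x))
  | ex x A, θ => ex x (A.subst (Function.update θ x x))

/-- No variable becomes bound in the substitution `A.subst θ`. -/
def FreeFor : Formula → (ℕ → ℕ) → Prop
  | bot, _ => True
  | top, _ => True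
  | atom _ _ _, _ => True
  | conj A B, θ => A.FreeFor θ ∧ B.FreeFor θ
  | disj A B, θ => A.FreeFor θ ∧ B.FreeFor θ
  | imp A B, θ => A.FreeFor θ ∧ B.FreeFor θ
  | all x A, θ => (∀ y ∈ A.fv.erase x, θ y ≠ x) ∧ A.FreeFor (Function.update θ x x)
  | ex x A, θ => (∀ y ∈ A.fv.erase x, θ y ≠ x) ∧ A.FreeFor (Function.update θ x x)

/-- The substitution `[t / x]`. -/
def single (t x : ℕ) : ℕ → ℕ := Function.update id x t

/-- `∀ x₁ … ∀ xₙ A`. -/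
def allList (xs : List ℕ) (A : Formula) : Formula := xs.foldr all A

/-- `∀ x₁ … ∀ xₙ (A → B)`; this is `A → B` if the list is empty. -/
def allImp (xs : List ℕ) (A B : Formula) : Formula := allList xs (imp A B)

/-- The formulas of the language of Basic Predicate Calculus: the universal quantifier
is used only in the form `∀ x₁ … xₙ (A → B)`. -/
inductive IsBasic : Formula → Prop
  | bot : IsBasic bot
  | top : IsBasic top
  | atom (n i : ℕ) (t : Fin n → ℕ) : IsBasic (atom n i t)
  | conj {A B : Formula} : IsBasic A → IsBasic B → IsBasic (conj A B)
  | disj {A B : Formula} : IsBasic A → IsBasic B → IsBasic (disj A B)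
  | ex {A : Formula} (x : ℕ) : IsBasic A → IsBasic (ex x A)
  | allImp {A B : Formula} (xs : List ℕ) : IsBasic A → IsBasic B → IsBasic (allImp xs A B)

/-! Every formula is uniquely `∀ x₁ … ∀ xₙ C` with `n ≥ 0` and `C` not a universal formula. The
list `x₁,…,xₙ` is `prefixVars`; `hyp` and `concl` are `Φ` and `Ψ` if `C` is `Φ → Ψ`, and `⊤` and
`C` otherwise. -/

/-- The variables of the maximal universal quantifier prefix. -/
def prefixVars : Formula → List ℕ
  | all x A => x :: A.prefixVars
  | _ => []

/-- The premise of the part after the universal prefix (`⊤` if that part is no implication). -/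
def hyp : Formula → Formula
  | all _ A => A.hyp
  | imp A _ => A
  | _ => top

/-- The conclusion of the part after the universal prefix (that part if it is no implication). -/
def concl : Formula → Formula
  | all _ A => A.concl
  | imp _ B => B
  | A => A

/-- The number of logical symbols and atoms of a formula. -/
def size : Formula → ℕ
  | bot => 1
  | top => 1
  | atom _ _ _ => 1
  | conj A B => A.size + B.size + 1
  | disj A B => A.size + B.size + 1
  | imp A B => A.size + B.size + 1
  | all _ A => A.size + 1
  | ex _ A => A.size + 1

theorem size_hyp_le (A : Formula) : A.hyp.size ≤ A.size := by
  induction A <;> simp only [hyp, size] <;> omega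

theorem size_concl_le (A : Formula) : A.concl.size ≤ A.size := by
  induction A <;> simp only [concl, size] <;> omega

end Formula

open Formula in
/-- Derivability in Intuitionistic Predicate Calculus. -/
inductive IPC : Formula → Prop
  | a1 : IPC top
  | a2 (A B : Formula) : IPC (imp A (imp B A))
  | a3 (A B C : Formula) :
      IPC (imp (imp A (imp B C)) (imp (imp A B) (imp A C)))
  | a4 (A B : Formula) : IPC (imp A (imp B (conj A B)))
  | a5 (A B : Formula) : IPC (imp (conj A B) A)
  | a6 (A B : Formula) : IPC (imp (conj A B) B)
  | a7 (A B C : Formula) : IPC (imp (imp A C) (imp (imp B C) (imp (disj A B) C)))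
  | a8 (A B : Formula) : IPC (imp A (disj A B))
  | a9 (A B : Formula) : IPC (imp B (disj A B))
  | a10 (A : Formula) : IPC (imp bot A)
  | a11 (A : Formula) (y t : ℕ) : A.FreeFor (single t y) →
      IPC (imp (all y A) (A.subst (single t y)))
  | a12 (A : Formula) (y t : ℕ) : A.FreeFor (single t y) →
      IPC (imp (A.subst (single t y)) (ex y A))
  | a13 (A B : Formula) (x : ℕ) : x ∉ B.fv →
      IPC (imp (all x (imp B A)) (imp B (all x A)))
  | a14 (A B : Formula) (x : ℕ) : x ∉ B.fv →
      IPC (imp (all x (imp A B)) (imp (ex x A) B))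
  | r1 {A B : Formula} : IPC A → IPC (imp A B) → IPC B
  | r2 {A : Formula} (y : ℕ) : IPC A → IPC (all y A)

open Formula in
/-- Derivability in Basic Predicate Calculus: `BQC A B` says that the sequent `A ⇒ B` (of formulas
of the language of Basic Predicate Calculus) is derivable. -/
inductive BQC : Formula → Formula → Prop
  | a1 {A : Formula} : A.IsBasic → BQC A A
  | a2 {A : Formula} : A.IsBasic → BQC A top
  | a3 {A : Formula} : A.IsBasic → BQC bot A
  | a4 {A B : Formula} (x : ℕ) : A.IsBasic → B.IsBasic → x ∉ A.fv →
      BQC (conj A (ex x B)) (ex x (conj A B))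
  | a5 {A B C : Formula} : A.IsBasic → B.IsBasic → C.IsBasic →
      BQC (conj A (disj B C)) (disj (conj A B) (conj A C))
  | a6 {A B C : Formula} (xs : List ℕ) : A.IsBasic → B.IsBasic → C.IsBasic →
      BQC (conj (allImp xs A B) (allImp xs B C)) (allImp xs A C)
  | a7 {A B C : Formula} (xs : List ℕ) : A.IsBasic → B.IsBasic → C.IsBasic →
      BQC (conj (allImp xs A B) (allImp xs A C)) (allImp xs A (conj B C))
  | a8 {A B C : Formula} (xs : List ℕ) : A.IsBasic → B.IsBasic → C.IsBasic →
      BQC (conj (allImp xs B A) (allImp xs C A)) (allImp xs (disj B C) A)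
  | a9 {A B : Formula} (xs : List ℕ) (θ : ℕ → ℕ) : A.IsBasic → B.IsBasic →
      (∀ y, y ∉ xs → θ y = y) → A.FreeFor θ → B.FreeFor θ →
      BQC (allImp xs A B) (allImp xs (A.subst θ) (B.subst θ))
  | a10 {A B : Formula} (xs ys : List ℕ) : A.IsBasic → B.IsBasic →
      (∀ y ∈ ys, y ∉ (allImp xs A B).fv) → BQC (allImp xs A B) (allImp ys A B)
  | a11 {A B : Formula} (xs : List ℕ) (x : ℕ) : A.IsBasic → B.IsBasic → x ∉ A.fv →
      BQC (allImp (xs ++ [x]) B A) (allImp xs (ex x B) A)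
  | r1 {A B C : Formula} : BQC A B → BQC B C → BQC A C
  | r2 {A B C : Formula} : BQC A B → BQC A C → BQC A (conj B C)
  | r3l {A B C : Formula} : BQC A (conj B C) → BQC A B
  | r3r {A B C : Formula} : BQC A (conj B C) → BQC A C
  | r4 {A B C : Formula} : BQC B A → BQC C A → BQC (disj B C) A
  | r5l {A B C : Formula} : BQC (disj B C) A → BQC B A
  | r5r {A B C : Formula} : BQC (disj B C) A → BQC C A
  | r6 {A B : Formula} (x t : ℕ) : A.FreeFor (single t x) → B.FreeFor (single t x) →
      BQC A B → BQC (A.subst (single t x)) (B.subst (single t x))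
  | r7 {A B : Formula} (x : ℕ) : x ∉ A.fv → BQC B A → BQC (ex x B) A
  | r8 {A B : Formula} (x : ℕ) : x ∉ A.fv → BQC (ex x B) A → BQC B A
  | r9 {A B C : Formula} (xs : List ℕ) : (∀ x ∈ xs, x ∉ A.fv) →
      BQC (conj A B) C → BQC A (allImp xs B C)

/-! ### Realizability -/

/-- `M`-evaluations: every `n`-ary predicate symbol is sent to a function from `Mⁿ` to the
subsets of `ℕ`. -/
abbrev Evaluation (M : Set ℕ) : Type := (n : ℕ) → ℕ → (Fin n → M) → Set ℕ

/-- The assignment `σ` with the values of the variables `x₁,…,xₙ` changed to `a₁,…,aₙ`. -/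
def assign {M : Set ℕ} : (ℕ → M) → (xs : List ℕ) → (Fin xs.length → M) → (ℕ → M)
  | σ, [], _ => σ
  | σ, x :: xs, a => assign (Function.update σ x (a 0)) xs (fun i => a i.succ)

open Formula in
/-- `Realizes W f A σ e`: the number `e` `V`-realizes on the `M`-evaluation `f` the `M`-sentence
obtained from `A` by putting the constants `σ x ∈ M` for the free variables `x`. -/
def Realizes (W : NumberedFunctions) {M : Set ℕ} (f : Evaluation M) :
    Formula → (ℕ → M) → ℕ → Prop
  | bot, _, _ => False
  | top, _, _ => True
  | atom n i t, σ, e => e ∈ f n i (σ ∘ t)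
  | conj A B, σ, e => Realizes W f A σ (W.p₁ e) ∧ Realizes W f B σ (W.p₂ e)
  | disj A B, σ, e =>
      (W.p₁ e = 0 ∧ Realizes W f A σ (W.p₂ e)) ∨ (W.p₁ e = 1 ∧ Realizes W f B σ (W.p₂ e))
  | imp A B, σ, e =>
      e ∈ W.I 1 ∧ ∀ s, Realizes W f A σ s → ∃ r ∈ W.φ 1 e ![s], Realizes W f B σ r
  | ex x A, σ, e =>
      ∃ h : W.p₁ e ∈ M, Realizes W f A (Function.update σ x ⟨W.p₁ e, h⟩) (W.p₂ e)
  | all x A, σ, e =>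
      -- the maximal block `∀ x ∀ x₂ … ∀ xₙ` in front of `Φ → Ψ` (or of `Ψ`, read as `⊤ → Ψ`)
      e ∈ W.I ((x :: A.prefixVars).length + 1) ∧
      ∀ (s : ℕ) (a : Fin (x :: A.prefixVars).length → M),
        Realizes W f A.hyp (assign σ (x :: A.prefixVars) a) s →
        ∃ r ∈ W.φ ((x :: A.prefixVars).length + 1) e
            (Fin.snoc (α := fun _ => ℕ) (fun i => (a i : ℕ)) s),
          Realizes W f A.concl (assign σ (x :: A.prefixVars) a) r
termination_by A => A.size
decreasing_by
  all_goals
    first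
    | (simp only [Formula.size]; omega)
    | (have := Formula.size_hyp_le A; simp only [Formula.size]; omega)
    | (have := Formula.size_concl_le A; simp only [Formula.size]; omega)

/-- Absolute `V`-realizability over all domains (of a sentence `A`): one number realizes `A` on
all evaluations, whatever their nonempty domain `M` is. (For a sentence `σ` is irrelevant.) -/
def AbsRealizable (W : NumberedFunctions) (A : Formula) : Prop :=
  ∃ e : ℕ, ∀ M : Set ℕ, M.Nonempty → ∀ (f : Evaluation M) (σ : ℕ → M), Realizes W f A σ e

/-- Soundness of Basic Predicate Calculus for absolute `V`-realizability over all domains: if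
`A ⇒ B` is derivable and its free variables are in the nonempty list `z₁,…,zₘ` of distinct
variables, then the sentence `∀ z₁ … zₘ (A → B)` is absolutely `V`-realizable over all domains. -/
def BQCSound (W : NumberedFunctions) : Prop :=
  ∀ (A B : Formula) (zs : List ℕ), zs ≠ [] → zs.Nodup → A.fv ∪ B.fv ⊆ zs.toFinset →
    BQC A B → AbsRealizable W (Formula.allImp zs A B)

/-- Soundness of Intuitionistic Predicate Calculus for absolute `V`-realizability over all domains:
if `A` is derivable and its free variables are in the nonempty list `z₁,…,zₘ` of distinct
variables, then the sentence `∀ z₁ … ∀ zₘ A` is absolutely `V`-realizable over all domains. -/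
def IPCSound (W : NumberedFunctions) : Prop :=
  ∀ (A : Formula) (zs : List ℕ), zs ≠ [] → zs.Nodup → A.fv ⊆ zs.toFinset →
    IPC A → AbsRealizable W (Formula.allList zs A)

end VReal

/-! Soundness of BQC. A derivable sequent is interpreted by one `V`-function that turns the values
of the variables and a realizer of the antecedent into a realizer of the succedent (`Valid`); this
is proved by induction on the derivation (`BQC.valid`). A realizer of an implication is merely an
index, and the principles of BQC about implications only build new indices out of given ones: by
composition, by case distinction, by rearranging arguments, by freezing some arguments as constants.
(Cm), (Cs) and (Cn) supply exactly these operations, computably on indices. No principle of BQC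
makes a `V`-function apply an index that it receives as an argument, so no universal function is
ever needed.

The relation `Idx` enforces this discipline: the parameters `ρ`, from which an index is computed,
are kept apart from the arguments `x` of the function so indexed. Partial functions are handled
through relations that a `V`-function has to extend, since realizability asks for values on
realizers only and leaves all other inputs free.

Failure of IPC. Modus ponens as an implication, `P ∧ (P → Q) → Q`, does apply a received index. With
`P` interpreted as `{a}` and `Q` as `{k}`, an index `i` of a unary function realizes `P → Q` as soon
as `φ_i(a) = k`, and a realizer of the formula must then send the pair of `a` and `i` to `k`. Since
it may not depend on the interpretation, it computes an overuniversal function. -/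

namespace VReal

/-! ### Closure properties of `V`-functions and of computable families of indices -/

/-- The first `n` entries of a sequence. -/
def initial (n : ℕ) (x : ℕ → ℕ) : Fin n → ℕ := fun i => x i

theorem mem_evalAll {n : ℕ} {g : Fin n → Part ℕ} {v : Fin n → ℕ} :
    v ∈ evalAll g ↔ ∀ i, v i ∈ g i := by
  constructor
  · rintro ⟨h, rfl⟩ i
    exact ⟨h i, rfl⟩
  · intro h
    refine ⟨fun i => (h i).1, ?_⟩
    funext i
    exact (h i).2

theorem initial_succ (n : ℕ) (x : ℕ → ℕ) :
    initial (n + 1) x = Fin.snoc (α := fun _ => ℕ) (initial n x) (x n) := by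
  funext i
  refine Fin.lastCases ?_ (fun j => ?_) i <;> simp [initial]

namespace NumberedFunctions

variable {W : NumberedFunctions}

theorem exists_index {n : ℕ} {g : PartialFn n} (hg : g ∈ W.V n) : ∃ e ∈ W.I n, W.φ n e = g := by
  rwa [← W.numbering n] at hg

theorem φ_mem {n e : ℕ} (he : e ∈ W.I n) : W.φ n e ∈ W.V n := by
  rw [← W.numbering n]
  exact ⟨e, he, rfl⟩

@[simp] theorem p₁_c (a b : ℕ) : W.p₁ (W.c (a, b)) = a := by simp [p₁]

@[simp] theorem p₂_c (a b : ℕ) : W.p₂ (W.c (a, b)) = b := by simp [p₂]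

/-- Form of (Cm) used below: the maximal arity becomes a free variable, which avoids casts, and
arguments are initial segments of one sequence, so that inner functions of different arities fit
together. -/
theorem Cm.exists_comp (h : W.Cm) {n m : ℕ} (ms : Fin n → ℕ) (hm : Finset.univ.sup ms = m) :
    ∃ s ∈ W.V (n + 1), ∀ e ∈ W.I n, ∀ es : Fin n → ℕ, (∀ i, es i ∈ W.I (ms i)) →
      ∃ k ∈ s (Fin.cons e es), k ∈ W.I m ∧ ∀ (x : ℕ → ℕ) (v : Fin n → ℕ) (r : ℕ),
        (∀ i, v i ∈ W.φ (ms i) (es i) (initial (ms i) x)) → r ∈ W.φ n e v →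
          r ∈ W.φ m k (initial m x) := by
  subst hm
  obtain ⟨s, hs, H⟩ := h n ms
  refine ⟨s, hs, fun e he es hes => ?_⟩
  obtain ⟨k, hk, hkI, hφ⟩ := H e he es hes
  refine ⟨k, hk, hkI, fun x v r hv hr => ?_⟩
  rw [hφ]
  exact Part.mem_bind (mem_evalAll.2 hv) hr

/-- Some `n`-ary `V`-function, applied to the first `n` entries, extends the relation `G` between
sequences and values. -/
def CompAt (W : NumberedFunctions) (n : ℕ) (G : (ℕ → ℕ) → ℕ → Prop) : Prop :=
  ∃ g ∈ W.V n, ∀ x r, G x r → r ∈ g (initial n x)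

/-- Some `V`-function of positive arity extends `G`. -/
def Comp (W : NumberedFunctions) (G : (ℕ → ℕ) → ℕ → Prop) : Prop :=
  ∃ n, 1 ≤ n ∧ W.CompAt n G

/-- The `n`-ary partial functions extending the `F ρ`, for parameters `ρ` in `D`, have indices
computed by a `V`-function of (finitely many entries of) `ρ`. -/
def Idx (W : NumberedFunctions) (n : ℕ) (D : (ℕ → ℕ) → Prop)
    (F : (ℕ → ℕ) → (ℕ → ℕ) → ℕ → Prop) : Prop :=
  ∃ J, W.Comp J ∧ ∀ ρ, D ρ → ∃ j, J ρ j ∧ j ∈ W.I n ∧ ∀ x r, F ρ x r → r ∈ W.φ n j (initial n x)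

theorem CompAt.mono {n : ℕ} {G G' : (ℕ → ℕ) → ℕ → Prop} (h : W.CompAt n G)
    (hG : ∀ x r, G' x r → G x r) : W.CompAt n G' := by
  obtain ⟨g, hg, H⟩ := h
  exact ⟨g, hg, fun x r hr => H x r (hG x r hr)⟩

theorem Comp.mono {G G' : (ℕ → ℕ) → ℕ → Prop} (h : W.Comp G)
    (hG : ∀ x r, G' x r → G x r) : W.Comp G' := by
  obtain ⟨n, hn, h⟩ := h
  exact ⟨n, hn, h.mono hG⟩

theorem Idx.mono {n : ℕ} {D : (ℕ → ℕ) → Prop} {F F' : (ℕ → ℕ) → (ℕ → ℕ) → ℕ → Prop}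
    (h : W.Idx n D F) (hF : ∀ ρ x r, D ρ → F' ρ x r → F ρ x r) : W.Idx n D F' := by
  obtain ⟨J, hJ, H⟩ := h
  refine ⟨J, hJ, fun ρ hρ => ?_⟩
  obtain ⟨j, h1, h2, h3⟩ := H ρ hρ
  exact ⟨j, h1, h2, fun x r hr => h3 x r (hF ρ x r hρ hr)⟩

theorem CompAt.var (hW : W.IsBasicModel) {n i : ℕ} (hi : i < n) :
    W.CompAt n (fun x r => r = x i) := by
  refine ⟨_, hW.1.1 n ⟨i, hi⟩, ?_⟩
  rintro x r rfl
  simp [initial]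

theorem CompAt.comp (hW : W.IsBasicModel) {n m : ℕ} (hn : 1 ≤ n) {g : PartialFn n}
    (hg : g ∈ W.V n) {H : Fin n → (ℕ → ℕ) → ℕ → Prop} (hH : ∀ i, W.CompAt m (H i)) :
    W.CompAt m (fun x r => ∃ v : Fin n → ℕ, (∀ i, H i x (v i)) ∧ r ∈ g v) := by
  choose h hhV hh using hH
  obtain ⟨e, heI, rfl⟩ := exists_index hg
  choose es hes hφ using fun i => exists_index (hhV i)
  have : Nonempty (Fin n) := ⟨⟨0, hn⟩⟩
  obtain ⟨s, -, hs⟩ := hW.2.1.exists_comp (fun _ : Fin n => m)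
    (Finset.sup_const Finset.univ_nonempty m)
  obtain ⟨k, -, hkI, hk⟩ := hs e heI es hes
  refine ⟨W.φ m k, φ_mem hkI, ?_⟩
  rintro x r ⟨v, hv, hr⟩
  refine hk x v r (fun i => ?_) hr
  rw [hφ]
  exact hh i x _ (hv i)

/-- Dummy arguments come from composing with projections. Positive arity is essential: with no inner
functions, the composition in (Cm) has arity `0`. -/
theorem CompAt.lift (hW : W.IsBasicModel) {n m : ℕ} (hn : 1 ≤ n) (hm : n ≤ m)
    {G : (ℕ → ℕ) → ℕ → Prop} (h : W.CompAt n G) : W.CompAt m G := by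
  obtain ⟨g, hg, H⟩ := h
  refine (CompAt.comp hW hn hg fun i => CompAt.var hW (i.2.trans_le hm)).mono fun x r hr => ?_
  exact ⟨initial n x, fun i => rfl, H x r hr⟩

theorem Comp.comp (hW : W.IsBasicModel) {n : ℕ} (hn : 1 ≤ n) {g : PartialFn n}
    (hg : g ∈ W.V n) {H : Fin n → (ℕ → ℕ) → ℕ → Prop} (hH : ∀ i, W.Comp (H i)) :
    W.Comp (fun x r => ∃ v : Fin n → ℕ, (∀ i, H i x (v i)) ∧ r ∈ g v) := by
  choose ms hms hH using hH
  have hle : ∀ i, ms i ≤ Finset.univ.sup ms := fun i => Finset.le_sup (Finset.mem_univ i)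
  exact ⟨_, (hms ⟨0, hn⟩).trans (hle _),
    CompAt.comp hW hn hg fun i => (hH i).lift hW (hms i) (hle i)⟩

theorem Comp.var (hW : W.IsBasicModel) (i : ℕ) : W.Comp (fun x r => r = x i) :=
  ⟨i + 1, by omega, CompAt.var hW (by omega)⟩

/-- Substitution of tracked values for all the arguments of a tracked relation. -/
theorem Comp.bind (hW : W.IsBasicModel) {G : (ℕ → ℕ) → ℕ → Prop} (hG : W.Comp G)
    {H : ℕ → (ℕ → ℕ) → ℕ → Prop} (hH : ∀ i, W.Comp (H i)) :
    W.Comp (fun x r => ∃ v : ℕ → ℕ, (∀ i, H i x (v i)) ∧ G v r) := by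
  obtain ⟨n, hn, g, hg, hG⟩ := hG
  refine (Comp.comp hW hn hg (H := fun i => H i) fun i => hH i).mono ?_
  rintro x r ⟨v, hv, hr⟩
  exact ⟨initial n v, fun i => hv i, hG v r hr⟩

theorem Comp.subst (hW : W.IsBasicModel) {G : (ℕ → ℕ) → ℕ → Prop} (hG : W.Comp G)
    {h : ℕ → (ℕ → ℕ) → ℕ} (hh : ∀ i, W.Comp (fun x r => r = h i x)) :
    W.Comp (fun x r => G (fun i => h i x) r) :=
  (Comp.bind hW hG hh).mono fun _ _ hr => ⟨_, fun _ => rfl, hr⟩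

theorem Comp.pair (hW : W.IsBasicModel) {F G : (ℕ → ℕ) → ℕ → Prop} (hF : W.Comp F)
    (hG : W.Comp G) : W.Comp (fun x r => ∃ a b, F x a ∧ G x b ∧ r = W.c (a, b)) := by
  refine (Comp.comp hW (by omega) hW.1.2.1 (H := ![F, G]) ?_).mono ?_
  · simp [Fin.forall_fin_two, hF, hG]
  · rintro x r ⟨a, b, ha, hb, rfl⟩
    exact ⟨![a, b], by simp [Fin.forall_fin_two, ha, hb], by simp⟩

theorem Comp.fst (hW : W.IsBasicModel) {G : (ℕ → ℕ) → ℕ → Prop}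
    (hG : W.Comp G) : W.Comp (fun x r => ∃ a, G x a ∧ r = W.p₁ a) := by
  refine (Comp.comp hW le_rfl hW.1.2.2.1 (H := fun _ => G) fun _ => hG).mono ?_
  rintro x r ⟨a, ha, rfl⟩
  exact ⟨fun _ => a, fun _ => ha, by simp⟩

theorem Comp.snd (hW : W.IsBasicModel) {G : (ℕ → ℕ) → ℕ → Prop}
    (hG : W.Comp G) : W.Comp (fun x r => ∃ a, G x a ∧ r = W.p₂ a) := by
  refine (Comp.comp hW le_rfl hW.1.2.2.2 (H := fun _ => G) fun _ => hG).mono ?_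
  rintro x r ⟨a, ha, rfl⟩
  exact ⟨fun _ => a, fun _ => ha, by simp⟩

theorem Comp.pair_eq (hW : W.IsBasicModel) {f g : (ℕ → ℕ) → ℕ} (hf : W.Comp fun x r => r = f x)
    (hg : W.Comp fun x r => r = g x) : W.Comp (fun x r => r = W.c (f x, g x)) :=
  (hf.pair hW hg).mono fun _ _ hr => ⟨_, _, rfl, rfl, hr⟩

theorem Comp.fst_eq (hW : W.IsBasicModel) {f : (ℕ → ℕ) → ℕ} (hf : W.Comp fun x r => r = f x) :
    W.Comp (fun x r => r = W.p₁ (f x)) :=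
  (hf.fst hW).mono fun _ _ hr => ⟨_, rfl, hr⟩

theorem Comp.snd_eq (hW : W.IsBasicModel) {f : (ℕ → ℕ) → ℕ} (hf : W.Comp fun x r => r = f x) :
    W.Comp (fun x r => r = W.p₂ (f x)) :=
  (hf.snd hW).mono fun _ _ hr => ⟨_, rfl, hr⟩

/-- Indices of the constant functions of a positive arity. -/
theorem exists_const_index (hW : W.IsBasicModel) {n : ℕ} (hn : 1 ≤ n) :
    ∃ s ∈ W.V 3, ∃ t ∈ W.V 1, ∃ e₁ e₂ : ℕ, ∀ k, ∃ i ∈ t ![k], ∃ j ∈ s ![e₁, i, e₂],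
      j ∈ W.I n ∧ ∀ x, k ∈ W.φ n j (initial n x) := by
  obtain ⟨t, ht, hk⟩ := hW.2.2.1
  obtain ⟨e₁, he₁, hφ₁⟩ := exists_index (hW.1.1 2 0)
  obtain ⟨e₂, he₂, hφ₂⟩ := exists_index (hW.1.1 n ⟨0, hn⟩)
  -- A nullary constant is raised to arity `n = max 0 n` by pairing it with an `n`-ary projection
  -- and keeping the first component.
  obtain ⟨s, hs, H⟩ := hW.2.1.exists_comp (n := 2) (m := n) ![0, n] (by
    apply le_antisymm
    · apply Finset.sup_le
      simp [Fin.forall_fin_two]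
    · exact Finset.le_sup (f := ![0, n]) (Finset.mem_univ (1 : Fin 2)))
  refine ⟨s, hs, t, ht, e₁, e₂, fun k => ?_⟩
  obtain ⟨i, hi, hiI, hφ⟩ := hk k
  obtain ⟨j, hj, hjI, hr⟩ := H e₁ he₁ ![i, e₂] (by simp [Fin.forall_fin_two, hiI, he₂])
  refine ⟨i, hi, j, hj, hjI, fun x => hr x ![k, x 0] k ?_ (by simp [hφ₁])⟩
  have h0 : initial 0 x = ![] := Subsingleton.elim _ _
  simp [Fin.forall_fin_two, h0, hφ, hφ₂, initial]

theorem Comp.const (hW : W.IsBasicModel) (k : ℕ) : W.Comp (fun _ r => r = k) := by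
  obtain ⟨s, -, t, -, e₁, e₂, H⟩ := exists_const_index hW le_rfl
  obtain ⟨i, -, j, -, hjI, hr⟩ := H k
  refine ⟨1, le_rfl, _, φ_mem hjI, ?_⟩
  rintro x r rfl
  exact hr x

/-- A received index may be used inside a new function because it depends on the parameters only and
is its own index. Were `h` allowed to depend on `x`, this would demand a universal function. -/
theorem Idx.of_index {n : ℕ} {D : (ℕ → ℕ) → Prop} {h : (ℕ → ℕ) → ℕ}
    (hh : W.Comp fun x r => r = h x) (hD : ∀ ρ, D ρ → h ρ ∈ W.I n) :
    W.Idx n D (fun ρ x r => r ∈ W.φ n (h ρ) (initial n x)) :=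
  ⟨_, hh, fun ρ hρ => ⟨_, rfl, hD ρ hρ, fun _ _ hr => hr⟩⟩

theorem Idx.of_compAt (hW : W.IsBasicModel) {n : ℕ} {D : (ℕ → ℕ) → Prop}
    {G : (ℕ → ℕ) → ℕ → Prop} (hG : W.CompAt n G) : W.Idx n D (fun _ x r => G x r) := by
  obtain ⟨g, hg, h⟩ := hG
  obtain ⟨e, he, rfl⟩ := exists_index hg
  exact (Idx.of_index (Comp.const hW e) fun _ _ => he).mono fun _ x r _ hr => h x r hr

theorem Idx.compAt {n : ℕ} {D : (ℕ → ℕ) → Prop} {F : (ℕ → ℕ) → (ℕ → ℕ) → ℕ → Prop}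
    (h : W.Idx n D F) {ρ : ℕ → ℕ} (hρ : D ρ) : W.CompAt n (F ρ) := by
  obtain ⟨J, -, H⟩ := h
  obtain ⟨j, -, hjI, hj⟩ := H ρ hρ
  exact ⟨_, φ_mem hjI, hj⟩

theorem Idx.var (hW : W.IsBasicModel) {n i : ℕ} (hi : i < n) {D : (ℕ → ℕ) → Prop} :
    W.Idx n D (fun _ x r => r = x i) :=
  Idx.of_compAt hW (CompAt.var hW hi)

/-- Freezes a parameter as a constant function whose index is computed by (Cn). Together with
`Idx.subst` this plays the role of the s-m-n theorem. -/
theorem Idx.param (hW : W.IsBasicModel) {n : ℕ} (hn : 1 ≤ n) {D : (ℕ → ℕ) → Prop}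
    {h : (ℕ → ℕ) → ℕ} (hh : W.Comp fun x r => r = h x) :
    W.Idx n D (fun ρ _ r => r = h ρ) := by
  obtain ⟨s, hs, t, ht, e₁, e₂, H⟩ := exists_const_index hW hn
  have h1 := Comp.comp hW le_rfl ht (H := fun _ => fun x r => r = h x) fun _ => hh
  refine ⟨_, Comp.comp hW (by omega) hs (H := ![fun _ r => r = e₁,
    fun x r => ∃ v : Fin 1 → ℕ, (∀ i, v i = h x) ∧ r ∈ t v, fun _ r => r = e₂]) ?_, ?_⟩
  · intro i
    fin_cases i
    · exact Comp.const hW e₁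
    · exact h1
    · exact Comp.const hW e₂
  · intro ρ _
    obtain ⟨i, hi, j, hj, hjI, hr⟩ := H (h ρ)
    refine ⟨j, ⟨![e₁, i, e₂], ?_, hj⟩, hjI, ?_⟩
    · intro l
      fin_cases l
      · rfl
      · refine ⟨![h ρ], ?_, hi⟩
        simp
      · rfl
    · rintro x r rfl
      exact hr x

/-- The uniformity of (Cm) is what counts: its index function is applied to the indices of the outer
and inner functions, all computed from `ρ`. -/
theorem Idx.comp (hW : W.IsBasicModel) {n k : ℕ} (hk : 1 ≤ k) {D : (ℕ → ℕ) → Prop}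
    {F : (ℕ → ℕ) → (ℕ → ℕ) → ℕ → Prop} (hF : W.Idx k D F)
    {H : ℕ → (ℕ → ℕ) → (ℕ → ℕ) → ℕ → Prop} (hH : ∀ i < k, W.Idx n D (H i)) :
    W.Idx n D (fun ρ x r => ∃ v : ℕ → ℕ, (∀ i < k, H i ρ x (v i)) ∧ F ρ v r) := by
  obtain ⟨J, hJ, hF⟩ := hF
  choose! K hK hH using hH
  have : Nonempty (Fin k) := ⟨⟨0, hk⟩⟩
  obtain ⟨s, hs, hc⟩ := hW.2.1.exists_comp (fun _ : Fin k => n)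
    (Finset.sup_const Finset.univ_nonempty n)
  refine ⟨_, Comp.comp hW (by omega) hs
    (H := Fin.cons (α := fun _ => (ℕ → ℕ) → ℕ → Prop) J fun i : Fin k => K i) ?_, ?_⟩
  · intro i
    refine Fin.cases ?_ (fun i => ?_) i
    · simpa using hJ
    · simpa using hK i i.2
  · intro ρ hρ
    obtain ⟨e, he, heI, hφ⟩ := hF ρ hρ
    choose es hes hesI hesφ using fun i : Fin k => hH i i.2 ρ hρ
    obtain ⟨j, hj, hjI, hr⟩ := hc e heI es hesI
    refine ⟨j, ⟨_, ?_, hj⟩, hjI, ?_⟩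
    · intro i
      refine Fin.cases ?_ (fun i => ?_) i
      · simpa using he
      · simpa using hes i
    · rintro x r ⟨v, hv, hFr⟩
      exact hr x (initial k v) r (fun i => hesφ i x _ (hv i i.2)) (hφ v r hFr)

theorem Idx.subst (hW : W.IsBasicModel) {n k : ℕ} (hk : 1 ≤ k) {D : (ℕ → ℕ) → Prop}
    {F : (ℕ → ℕ) → (ℕ → ℕ) → ℕ → Prop} (hF : W.Idx k D F)
    {h : ℕ → (ℕ → ℕ) → (ℕ → ℕ) → ℕ} (hh : ∀ i < k, W.Idx n D (fun ρ x r => r = h i ρ x)) :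
    W.Idx n D (fun ρ x r => F ρ (fun i => h i ρ x) r) :=
  (Idx.comp hW hk hF hh).mono fun _ _ _ _ hr => ⟨_, fun _ _ => rfl, hr⟩

theorem Idx.pair (hW : W.IsBasicModel) {n : ℕ} {D : (ℕ → ℕ) → Prop}
    {F G : (ℕ → ℕ) → (ℕ → ℕ) → ℕ → Prop} (hF : W.Idx n D F) (hG : W.Idx n D G) :
    W.Idx n D (fun ρ x r => ∃ a b, F ρ x a ∧ G ρ x b ∧ r = W.c (a, b)) := by
  have hc : W.CompAt 2 (fun x r => r = W.c (x 0, x 1)) :=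
    ⟨_, hW.1.2.1, by rintro x r rfl; simp [initial]⟩
  refine (Idx.comp hW (by omega) (Idx.of_compAt hW hc)
    (H := fun i => if i = 0 then F else G) ?_).mono ?_
  · intro i _
    by_cases hi : i = 0 <;> simp [hi, hF, hG]
  · rintro ρ x r _ ⟨a, b, ha, hb, rfl⟩
    refine ⟨fun i => if i = 0 then a else b, fun i _ => ?_, by simp⟩
    by_cases hi : i = 0 <;> simp [hi, ha, hb]

theorem Idx.pair_eq (hW : W.IsBasicModel) {n : ℕ} {D : (ℕ → ℕ) → Prop}
    {f g : (ℕ → ℕ) → (ℕ → ℕ) → ℕ} (hf : W.Idx n D fun ρ x r => r = f ρ x)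
    (hg : W.Idx n D fun ρ x r => r = g ρ x) : W.Idx n D (fun ρ x r => r = W.c (f ρ x, g ρ x)) :=
  (hf.pair hW hg).mono fun _ _ _ _ hr => ⟨_, _, rfl, rfl, hr⟩

theorem Idx.fst_eq (hW : W.IsBasicModel) {n : ℕ} {D : (ℕ → ℕ) → Prop}
    {f : (ℕ → ℕ) → (ℕ → ℕ) → ℕ} (hf : W.Idx n D fun ρ x r => r = f ρ x) :
    W.Idx n D (fun ρ x r => r = W.p₁ (f ρ x)) := by
  have hc : W.CompAt 1 (fun x r => r = W.p₁ (x 0)) :=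
    ⟨_, hW.1.2.2.1, by rintro x r rfl; simp [initial]⟩
  exact Idx.subst hW le_rfl (Idx.of_compAt hW hc) (h := fun _ => f) fun _ _ => hf

theorem Idx.snd_eq (hW : W.IsBasicModel) {n : ℕ} {D : (ℕ → ℕ) → Prop}
    {f : (ℕ → ℕ) → (ℕ → ℕ) → ℕ} (hf : W.Idx n D fun ρ x r => r = f ρ x) :
    W.Idx n D (fun ρ x r => r = W.p₂ (f ρ x)) := by
  have hc : W.CompAt 1 (fun x r => r = W.p₂ (x 0)) :=
    ⟨_, hW.1.2.2.2, by rintro x r rfl; simp [initial]⟩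
  exact Idx.subst hW le_rfl (Idx.of_compAt hW hc) (h := fun _ => f) fun _ _ => hf

theorem Idx.cases (hW : W.IsBasicModel) {n : ℕ} {D : (ℕ → ℕ) → Prop}
    {F G : (ℕ → ℕ) → (ℕ → ℕ) → ℕ → Prop} (hF : W.Idx n D F) (hG : W.Idx n D G)
    {d : (ℕ → ℕ) → (ℕ → ℕ) → ℕ} (hd : W.Idx n D fun ρ x r => r = d ρ x) :
    W.Idx n D (fun ρ x r => (d ρ x = 0 ∧ F ρ x r) ∨ (d ρ x ≠ 0 ∧ G ρ x r)) := by
  obtain ⟨J, hJ, hF⟩ := hF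
  obtain ⟨K, hK, hG⟩ := hG
  obtain ⟨s, hs, hc⟩ := hW.2.2.2 n
  -- (Cs) branches on an extra last argument, into which `d` is substituted afterwards. That
  -- overwrites entry `n`, on which the relations `F` and `G` may formally depend; `y` stands for
  -- the original sequence.
  have key : W.Idx (n + 1) D (fun ρ x r => ∃ y, initial n y = initial n x ∧
      ((x n = 0 ∧ F ρ y r) ∨ (x n ≠ 0 ∧ G ρ y r))) := by
    refine ⟨_, Comp.comp hW (by omega) hs (H := ![J, K]) ?_, ?_⟩
    · simp [Fin.forall_fin_two, hJ, hK]
    · intro ρ hρ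
      obtain ⟨e₁, h₁, h₁I, hφ₁⟩ := hF ρ hρ
      obtain ⟨e₂, h₂, h₂I, hφ₂⟩ := hG ρ hρ
      obtain ⟨j, hj, hjI, hφ⟩ := hc e₁ h₁I e₂ h₂I
      refine ⟨j, ⟨![e₁, e₂], by simp [Fin.forall_fin_two, h₁, h₂], hj⟩, hjI, ?_⟩
      rintro x r ⟨y, hy, ⟨h0, hr⟩ | ⟨h0, hr⟩⟩
      · rw [initial_succ, hφ, if_pos h0, ← hy]
        exact hφ₁ y r hr
      · rw [initial_succ, hφ, if_neg h0, ← hy]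
        exact hφ₂ y r hr
  refine (Idx.subst hW (by omega) key (h := fun i ρ x => if i < n then x i else d ρ x) ?_).mono ?_
  · intro i _
    by_cases hi : i < n
    · simpa [hi] using Idx.var hW hi
    · simpa [hi] using hd
  · intro ρ x r _ hr
    refine ⟨x, ?_, by simpa using hr⟩
    funext i
    simp [initial]

theorem Comp.cases (hW : W.IsBasicModel) {F G : (ℕ → ℕ) → ℕ → Prop} (hF : W.Comp F)
    (hG : W.Comp G) {d : (ℕ → ℕ) → ℕ} (hd : W.Comp fun x r => r = d x) :
    W.Comp (fun x r => (d x = 0 ∧ F x r) ∨ (d x ≠ 0 ∧ G x r)) := by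
  obtain ⟨n₁, h₁, hF⟩ := hF
  obtain ⟨n₂, h₂, hG⟩ := hG
  obtain ⟨n₃, h₃, hd⟩ := hd
  have hF' := hF.lift hW h₁ (m := n₁ + n₂ + n₃) (by omega)
  have hG' := hG.lift hW h₂ (m := n₁ + n₂ + n₃) (by omega)
  have hd' := hd.lift hW h₃ (m := n₁ + n₂ + n₃) (by omega)
  exact ⟨n₁ + n₂ + n₃, by omega, (Idx.cases hW (D := fun _ => True) (Idx.of_compAt hW hF')
    (Idx.of_compAt hW hG') (d := fun _ => d) (Idx.of_compAt hW hd')).compAt (ρ := id) trivial⟩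

end NumberedFunctions

end VReal

/-! ### Assignments along blocks of quantified variables -/

namespace VReal

open Formula

theorem assign_of_notMem {M : Set ℕ} {y : ℕ} : ∀ {xs : List ℕ} (σ : ℕ → M)
    (a : Fin xs.length → M), y ∉ xs → assign σ xs a y = σ y
  | [], _, _, _ => rfl
  | x :: xs, σ, a, h => by
    rw [List.mem_cons, not_or] at h
    rw [assign, assign_of_notMem _ _ h.2, Function.update_of_ne h.1]

/-- A block may repeat a variable; its last occurrence wins. That position depends on the list
alone, so a fixed projection reads off the value. -/
theorem exists_assign_eq {y : ℕ} : ∀ {xs : List ℕ}, y ∈ xs → ∃ i : Fin xs.length,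
    xs.get i = y ∧ ∀ (M : Set ℕ) (σ : ℕ → M) (a : Fin xs.length → M), assign σ xs a y = a i
  | x :: xs, h => by
    by_cases hy : y ∈ xs
    · obtain ⟨i, hi, H⟩ := exists_assign_eq hy
      exact ⟨i.succ, hi, fun M σ a => H M _ _⟩
    · obtain rfl : y = x := (List.mem_cons.1 h).resolve_right hy
      refine ⟨⟨0, by simp⟩, rfl, fun M σ a => ?_⟩
      rw [assign, assign_of_notMem _ _ hy, Function.update_self]
      rfl

theorem assign_values {M : Set ℕ} {xs : List ℕ} (σ τ : ℕ → M) {y : ℕ} (h : y ∈ xs) :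
    assign σ xs (fun i => τ (xs.get i)) y = τ y := by
  obtain ⟨i, hi, H⟩ := exists_assign_eq h
  rw [H, hi]

theorem assign_append_singleton {M : Set ℕ} (x : ℕ) : ∀ (xs : List ℕ) (σ : ℕ → M)
    (a : Fin (xs ++ [x]).length → M),
    assign σ (xs ++ [x]) a = Function.update
      (assign σ xs fun i => a ⟨i, by rw [List.length_append]; omega⟩) x (a ⟨xs.length, by simp⟩)
  | [], _, _ => rfl
  | y :: xs, σ, a => assign_append_singleton x xs (Function.update σ y (a ⟨0, by simp⟩)) fun i => a i.succ

theorem assign_congr {M : Set ℕ} {S : Set ℕ} : ∀ (xs : List ℕ) {σ τ : ℕ → M}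
    (a : Fin xs.length → M), (∀ y ∈ S, y ∉ xs → σ y = τ y) →
    ∀ y ∈ S, assign σ xs a y = assign τ xs a y := by
  intro xs σ τ a h y hy
  by_cases hx : y ∈ xs
  · obtain ⟨i, -, H⟩ := exists_assign_eq hx
    rw [H, H]
  · rw [assign_of_notMem _ _ hx, assign_of_notMem _ _ hx, h y hy hx]

theorem mem_fv_allImp {xs : List ℕ} {A B : Formula} {y : ℕ} :
    y ∈ (allImp xs A B).fv ↔ y ∉ xs ∧ (y ∈ A.fv ∨ y ∈ B.fv) := by
  induction xs with
  | nil => simp [allImp, allList, fv]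
  | cons x xs ih =>
    change y ∈ (allImp xs A B).fv.erase x ↔ _
    rw [Finset.mem_erase, ih, List.mem_cons]
    tauto

theorem fv_hyp_subset {A : Formula} {y : ℕ} (h : y ∈ A.hyp.fv) :
    y ∈ A.prefixVars ∨ y ∈ A.fv := by
  induction A with
  | all x A ih =>
    have := ih h
    by_cases hx : y = x <;> simp_all [prefixVars, fv]
  | _ => simp_all [prefixVars, hyp, fv]

theorem fv_concl_subset {A : Formula} {y : ℕ} (h : y ∈ A.concl.fv) :
    y ∈ A.prefixVars ∨ y ∈ A.fv := by
  induction A with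
  | all x A ih =>
    have := ih h
    by_cases hx : y = x <;> simp_all [prefixVars, fv]
  | _ => simp_all [prefixVars, concl, fv]

/-! ### Dependence of realizability on free variables, and substitution -/

section

variable {W : NumberedFunctions} {M : Set ℕ} {f : Evaluation M}

theorem realizes_all {x : ℕ} {A : Formula} {σ : ℕ → M} {e : ℕ} {xs : List ℕ}
    (hxs : xs = x :: A.prefixVars) :
    Realizes W f (all x A) σ e ↔ e ∈ W.I (xs.length + 1) ∧
      ∀ (s : ℕ) (a : Fin xs.length → M), Realizes W f A.hyp (assign σ xs a) s →
        ∃ r ∈ W.φ (xs.length + 1) e (Fin.snoc (α := fun _ => ℕ) (fun i => (a i : ℕ)) s),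
          Realizes W f A.concl (assign σ xs a) r := by
  subst hxs
  rw [Realizes]

theorem prefixVars_allImp (xs : List ℕ) (A B : Formula) : (allImp xs A B).prefixVars = xs := by
  induction xs with
  | nil => rfl
  | cons x xs ih => exact congrArg (x :: ·) ih

theorem hyp_allImp (xs : List ℕ) (A B : Formula) : (allImp xs A B).hyp = A := by
  induction xs with
  | nil => rfl
  | cons x xs ih => exact ih

theorem concl_allImp (xs : List ℕ) (A B : Formula) : (allImp xs A B).concl = B := by
  induction xs with
  | nil => rfl
  | cons x xs ih => exact ih

/-- Merges the clauses for `→` and `∀`: the matrix is an implication, so `xs` is the whole universal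
prefix, and an empty block leaves just the realizer argument. -/
theorem realizes_allImp {xs : List ℕ} {A B : Formula} {σ : ℕ → M} {e : ℕ} :
    Realizes W f (allImp xs A B) σ e ↔ e ∈ W.I (xs.length + 1) ∧
      ∀ (s : ℕ) (a : Fin xs.length → M), Realizes W f A (assign σ xs a) s →
        ∃ r ∈ W.φ (xs.length + 1) e (Fin.snoc (α := fun _ => ℕ) (fun i => (a i : ℕ)) s),
          Realizes W f B (assign σ xs a) r := by
  cases xs with
  | nil =>
    change Realizes W f (imp A B) σ e ↔ _
    rw [Realizes]
    refine and_congr Iff.rfl (forall_congr' fun s => ?_)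
    have h : ∀ a : Fin 0 → M, Fin.snoc (α := fun _ => ℕ) (fun i => (a i : ℕ)) s = ![s] := by
      intro a
      funext i
      fin_cases i
      rfl
    constructor
    · intro H a hs
      obtain ⟨r, hr, hB⟩ := H hs
      exact ⟨r, (h a).symm ▸ hr, hB⟩
    · intro H hs
      obtain ⟨r, hr, hB⟩ := H Fin.elim0 hs
      exact ⟨r, (h Fin.elim0) ▸ hr, hB⟩
  | cons x xs =>
    change Realizes W f (all x (allImp xs A B)) σ e ↔ _
    rw [realizes_all (by rw [prefixVars_allImp]), hyp_allImp, concl_allImp]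

/-- Induction on size rather than structure, because the clause for `∀` jumps over the whole prefix
to `hyp` and `concl`. -/
theorem realizes_congr (A : Formula) : ∀ {σ τ : ℕ → M}, (∀ y ∈ A.fv, σ y = τ y) →
    ∀ {e : ℕ}, Realizes W f A σ e → Realizes W f A τ e := by
  induction hn : A.size using Nat.strong_induction_on generalizing A with
  | _ n ih =>
  subst hn
  intro σ τ h e he
  cases A with
  | bot => simp [Realizes] at he
  | top => rw [Realizes]; trivial
  | atom n i t =>
    rw [Realizes] at he ⊢
    have : τ ∘ t = σ ∘ t := funext fun j => (h _ (by simp [fv])).symm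
    rwa [this]
  | conj A B =>
    rw [Realizes] at he ⊢
    simp only [fv, Finset.mem_union] at h
    exact ⟨ih _ (by simp only [size]; omega) A rfl (fun y hy => h y (.inl hy)) he.1,
      ih _ (by simp only [size]; omega) B rfl (fun y hy => h y (.inr hy)) he.2⟩
  | disj A B =>
    rw [Realizes] at he ⊢
    simp only [fv, Finset.mem_union] at h
    exact he.imp
      (And.imp_right (ih _ (by simp only [size]; omega) A rfl (fun y hy => h y (.inl hy))))
      (And.imp_right (ih _ (by simp only [size]; omega) B rfl (fun y hy => h y (.inr hy))))
  | imp A B =>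
    rw [Realizes] at he ⊢
    simp only [fv, Finset.mem_union] at h
    refine ⟨he.1, fun s hs => ?_⟩
    obtain ⟨r, hr, hB⟩ := he.2 s
      (ih _ (by simp only [size]; omega) A rfl (fun y hy => (h y (.inl hy)).symm) hs)
    exact ⟨r, hr, ih _ (by simp only [size]; omega) B rfl (fun y hy => h y (.inr hy)) hB⟩
  | ex x A =>
    rw [Realizes] at he ⊢
    obtain ⟨hm, he⟩ := he
    refine ⟨hm, ih _ (by simp [size]) A rfl (fun y hy => ?_) he⟩
    by_cases hx : y = x
    · simp [hx]
    · simpa [hx] using h y (Finset.mem_erase.2 ⟨hx, hy⟩)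
  | all x A =>
    rw [realizes_all rfl] at he ⊢
    have h1 := size_hyp_le A
    have h2 := size_concl_le A
    have hfv : ∀ y, y ∈ A.prefixVars ∨ y ∈ A.fv → y ∉ x :: A.prefixVars → σ y = τ y := by
      intro y hy hn
      rw [List.mem_cons, not_or] at hn
      exact h y (Finset.mem_erase.2 ⟨hn.1, hy.resolve_left hn.2⟩)
    refine ⟨he.1, fun s a hs => ?_⟩
    obtain ⟨r, hr, hB⟩ := he.2 s a (ih _ (by simp only [size]; omega) A.hyp rfl
      (assign_congr _ a fun y hy hn => (hfv y (fv_hyp_subset hy) hn).symm) hs)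
    exact ⟨r, hr, ih _ (by simp only [size]; omega) A.concl rfl
      (assign_congr _ a fun y hy hn => hfv y (fv_concl_subset hy) hn) hB⟩

/-- The substitution that acts on the matrix of a formula with the universal prefix `xs` when
`θ` acts on the formula. -/
def under (θ : ℕ → ℕ) (xs : List ℕ) : ℕ → ℕ := xs.foldl (fun θ x => Function.update θ x x) θ

theorem prefixVars_subst (A : Formula) : ∀ θ, (A.subst θ).prefixVars = A.prefixVars := by
  induction A with
  | all x A ih => intro θ; simp only [subst, prefixVars, ih]
  | _ => intro θ; rfl

theorem hyp_subst (A : Formula) : ∀ θ, (A.subst θ).hyp = A.hyp.subst (under θ A.prefixVars) := by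
  induction A with
  | all x A ih => intro θ; simp only [subst, hyp, ih, prefixVars]; rfl
  | _ => intro θ; rfl

theorem concl_subst (A : Formula) :
    ∀ θ, (A.subst θ).concl = A.concl.subst (under θ A.prefixVars) := by
  induction A with
  | all x A ih => intro θ; simp only [subst, concl, ih, prefixVars]; rfl
  | _ => intro θ; rfl

theorem freeFor_hyp (A : Formula) :
    ∀ {θ}, A.FreeFor θ → A.hyp.FreeFor (under θ A.prefixVars) := by
  induction A with
  | all x A ih => intro θ h; exact ih h.2
  | imp A B => intro θ h; exact h.1
  | _ => intro θ h; trivial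

theorem freeFor_concl (A : Formula) :
    ∀ {θ}, A.FreeFor θ → A.concl.FreeFor (under θ A.prefixVars) := by
  induction A with
  | all x A ih => intro θ h; exact ih h.2
  | imp A B => intro θ h; exact h.2
  | _ => intro θ h; exact h

/-- Peeling off a quantifier `∀ x`, freeness gives `θ z ≠ x` for the other free variables `z`, so
updating at `x` does not disturb their substituted values. -/
theorem assign_under (A : Formula) : ∀ {θ : ℕ → ℕ} (σ : ℕ → M) (a : Fin A.prefixVars.length → M),
    A.FreeFor θ → ∀ y, y ∈ A.hyp.fv ∨ y ∈ A.concl.fv →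
      assign σ A.prefixVars a (under θ A.prefixVars y) = assign (σ ∘ θ) A.prefixVars a y := by
  induction A with
  | all x A ih =>
    intro θ σ a h y hy
    refine (ih (Function.update σ x (a ⟨0, by simp [prefixVars]⟩))
      (fun i => a i.succ) h.2 y hy).trans ?_
    refine assign_congr (S := {y | y ∈ A.hyp.fv ∨ y ∈ A.concl.fv}) A.prefixVars _ ?_ y hy
    intro z hz hn
    by_cases hx : z = x
    · subst hx
      simp
      rfl
    · have hz' : z ∈ A.fv := (hz.elim fv_hyp_subset fv_concl_subset).resolve_left hn
      simp [hx, h.1 z (Finset.mem_erase.2 ⟨hx, hz'⟩)]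
  | _ => intro θ σ a _ y _; rfl

theorem realizes_subst (A : Formula) : ∀ {θ : ℕ → ℕ} {σ : ℕ → M} {e : ℕ}, A.FreeFor θ →
    (Realizes W f (A.subst θ) σ e ↔ Realizes W f A (σ ∘ θ) e) := by
  induction hn : A.size using Nat.strong_induction_on generalizing A with
  | _ n ih =>
  subst hn
  intro θ σ e h
  cases A with
  | bot => simp [subst, Realizes]
  | top => simp [subst, Realizes]
  | atom n i t => simp [subst, Realizes, Function.comp_assoc]
  | conj A B =>
    rw [subst, Realizes, Realizes, ih _ (by simp only [size]; omega) A rfl h.1,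
      ih _ (by simp only [size]; omega) B rfl h.2]
  | disj A B =>
    rw [subst, Realizes, Realizes, ih _ (by simp only [size]; omega) A rfl h.1,
      ih _ (by simp only [size]; omega) B rfl h.2]
  | imp A B =>
    rw [subst, Realizes, Realizes]
    refine and_congr Iff.rfl (forall_congr' fun s => ?_)
    rw [ih _ (by simp only [size]; omega) A rfl h.1]
    simp only [ih _ (by simp only [size]; omega) B rfl h.2]
  | ex x A =>
    rw [subst, Realizes, Realizes]
    refine exists_congr fun hm => ?_
    rw [ih _ (by simp [size]) A rfl h.2]
    have key : ∀ y ∈ A.fv, (Function.update σ x ⟨W.p₁ e, hm⟩ ∘ Function.update θ x x) y =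
        Function.update (σ ∘ θ) x ⟨W.p₁ e, hm⟩ y := by
      intro y hy
      by_cases hx : y = x
      · subst hx; simp
      · simp [hx, h.1 y (Finset.mem_erase.2 ⟨hx, hy⟩)]
    exact ⟨realizes_congr A key, realizes_congr A fun y hy => (key y hy).symm⟩
  | all x A =>
    have h1 := size_hyp_le A
    have h2 := size_concl_le A
    rw [subst, realizes_all (xs := x :: A.prefixVars) (by rw [prefixVars_subst]),
      realizes_all rfl, hyp_subst, concl_subst]
    refine and_congr Iff.rfl (forall_congr' fun s => forall_congr' fun a => ?_)
    have key := assign_under (all x A) σ a h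
    have e1 : ∀ s, Realizes W f (A.hyp.subst (under (Function.update θ x x) A.prefixVars))
        (assign σ (x :: A.prefixVars) a) s ↔
        Realizes W f A.hyp (assign (σ ∘ θ) (x :: A.prefixVars) a) s := by
      intro s
      rw [ih _ (by simp only [size]; omega) A.hyp rfl (freeFor_hyp A h.2)]
      exact ⟨realizes_congr _ fun y hy => key y (.inl hy),
        realizes_congr _ fun y hy => (key y (.inl hy)).symm⟩
    have e2 : ∀ s, Realizes W f (A.concl.subst (under (Function.update θ x x) A.prefixVars))
        (assign σ (x :: A.prefixVars) a) s ↔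
        Realizes W f A.concl (assign (σ ∘ θ) (x :: A.prefixVars) a) s := by
      intro s
      rw [ih _ (by simp only [size]; omega) A.concl rfl (freeFor_concl A h.2)]
      exact ⟨realizes_congr _ fun y hy => key y (.inr hy),
        realizes_congr _ fun y hy => (key y (.inr hy)).symm⟩
    rw [e1]
    simp only [e2]

end

end VReal

/-! ### Valid sequents and the principles of BQC -/

namespace VReal

open Formula NumberedFunctions

/-- The values of the variables preceded by the number `s`. -/
def env {M : Set ℕ} (σ : ℕ → M) (s : ℕ) : ℕ → ℕ
  | 0 => s
  | x + 1 => σ x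

@[simp] theorem env_zero {M : Set ℕ} (σ : ℕ → M) (s : ℕ) : env σ s 0 = s := rfl

@[simp] theorem env_succ {M : Set ℕ} (σ : ℕ → M) (s x : ℕ) : env σ s (x + 1) = σ x := rfl

/-- The entries `a₁,…,aₙ` followed by `s` forever. -/
def snocSeq {M : Set ℕ} {n : ℕ} (a : Fin n → M) (s : ℕ) : ℕ → ℕ :=
  fun i => if h : i < n then (a ⟨i, h⟩ : ℕ) else s

theorem initial_snocSeq {M : Set ℕ} {n : ℕ} (a : Fin n → M) (s : ℕ) :
    initial (n + 1) (snocSeq a s) = Fin.snoc (α := fun _ => ℕ) (fun i => (a i : ℕ)) s := by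
  funext i
  refine Fin.lastCases ?_ (fun j => ?_) i <;> simp [initial, snocSeq]

/-- A `V`-function of the values of the variables and of a realizer of `A` yields realizers
of `B`. -/
def Valid (W : NumberedFunctions) (A B : Formula) : Prop :=
  ∃ G, W.Comp G ∧ ∀ (M : Set ℕ) (f : Evaluation M) (σ : ℕ → M) (s : ℕ),
    Realizes W f A σ s → ∃ r, G (env σ s) r ∧ Realizes W f B σ r

variable {W : NumberedFunctions}

theorem realizes_conj {M : Set ℕ} {f : Evaluation M} {A B : Formula} {σ : ℕ → M} {e : ℕ} :
    Realizes W f (conj A B) σ e ↔ Realizes W f A σ (W.p₁ e) ∧ Realizes W f B σ (W.p₂ e) := by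
  rw [Realizes]

theorem realizes_disj {M : Set ℕ} {f : Evaluation M} {A B : Formula} {σ : ℕ → M} {e : ℕ} :
    Realizes W f (disj A B) σ e ↔ (W.p₁ e = 0 ∧ Realizes W f A σ (W.p₂ e)) ∨
      (W.p₁ e = 1 ∧ Realizes W f B σ (W.p₂ e)) := by
  rw [Realizes]

theorem realizes_ex {M : Set ℕ} {f : Evaluation M} {x : ℕ} {A : Formula} {σ : ℕ → M} {e : ℕ} :
    Realizes W f (ex x A) σ e ↔
      ∃ h : W.p₁ e ∈ M, Realizes W f A (Function.update σ x ⟨W.p₁ e, h⟩) (W.p₂ e) := by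
  rw [Realizes]

theorem Valid.of_fun {A B : Formula} {g : (ℕ → ℕ) → ℕ} (hg : W.Comp fun x r => r = g x)
    (h : ∀ (M : Set ℕ) (f : Evaluation M) (σ : ℕ → M) (s : ℕ),
      Realizes W f A σ s → Realizes W f B σ (g (env σ s))) : Valid W A B :=
  ⟨_, hg, fun M f σ s hs => ⟨_, rfl, h M f σ s hs⟩⟩

/-- Change of the arguments in a valid sequent. -/
theorem Valid.subst (hW : W.IsBasicModel) {A B A' B' : Formula} (hV : Valid W A B)
    (v : ℕ → (ℕ → ℕ) → ℕ) (hv : ∀ i : ℕ, W.Comp fun x r => r = v i x)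
    (h : ∀ (M : Set ℕ) (f : Evaluation M) (σ : ℕ → M) (s : ℕ), Realizes W f A' σ s →
      ∃ τ : ℕ → M, ∃ t, (∀ i, v i (env σ s) = env τ t i) ∧ Realizes W f A τ t ∧
        ∀ r, Realizes W f B τ r → Realizes W f B' σ r) : Valid W A' B' := by
  obtain ⟨G, hG, H⟩ := hV
  refine ⟨_, hG.subst hW hv, fun M f σ s hs => ?_⟩
  obtain ⟨τ, t, hτ, ht, hB⟩ := h M f σ s hs
  obtain ⟨r, hr, hr'⟩ := H M f τ t ht
  refine ⟨r, ?_, hB r hr'⟩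
  rwa [show (fun i => v i (env σ s)) = env τ t from funext hτ]

/-- A realizer of the succedent is an index, so computing indices from `env σ s` suffices. `D`
records what the antecedent guarantees, typically that components of `s` are genuine indices. -/
theorem Valid.of_idx {C A B : Formula} {ys : List ℕ} {D : (ℕ → ℕ) → Prop}
    {F : (ℕ → ℕ) → (ℕ → ℕ) → ℕ → Prop} (hF : W.Idx (ys.length + 1) D F)
    (h : ∀ (M : Set ℕ) (f : Evaluation M) (σ : ℕ → M) (s : ℕ), Realizes W f C σ s →
      D (env σ s) ∧ ∀ (t : ℕ) (b : Fin ys.length → M), Realizes W f A (assign σ ys b) t →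
        ∃ r, F (env σ s) (snocSeq b t) r ∧ Realizes W f B (assign σ ys b) r) :
    Valid W C (allImp ys A B) := by
  obtain ⟨J, hJ, hF⟩ := hF
  refine ⟨J, hJ, fun M f σ s hs => ?_⟩
  obtain ⟨hD, H⟩ := h M f σ s hs
  obtain ⟨j, hj, hjI, hφ⟩ := hF _ hD
  refine ⟨j, hj, realizes_allImp.2 ⟨hjI, fun t b ht => ?_⟩⟩
  obtain ⟨r, hr, hB⟩ := H t b ht
  exact ⟨r, initial_snocSeq b t ▸ hφ _ _ hr, hB⟩

/-- The value of the variable `y` in `assign σ ys b`, given by `env σ s` and `snocSeq b t`, has an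
index computed from the former. -/
theorem exists_lookup (hW : W.IsBasicModel) (ys : List ℕ) (y : ℕ) :
    ∃ l : (ℕ → ℕ) → (ℕ → ℕ) → ℕ,
      (∀ D, W.Idx (ys.length + 1) D (fun ρ x r => r = l ρ x)) ∧
      ∀ (M : Set ℕ) (σ : ℕ → M) (s : ℕ) (b : Fin ys.length → M) (t : ℕ),
        l (env σ s) (snocSeq b t) = assign σ ys b y := by
  by_cases hy : y ∈ ys
  · obtain ⟨i, -, hi⟩ := exists_assign_eq hy
    refine ⟨fun _ x => x i, fun D => Idx.var hW (i.2.trans (Nat.lt_succ_self _)), ?_⟩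
    intro M σ s b t
    simp [snocSeq, hi]
  · refine ⟨fun ρ _ => ρ (y + 1), fun D => Idx.param hW (by omega) (Comp.var hW _), ?_⟩
    intro M σ s b t
    rw [assign_of_notMem _ _ hy]
    rfl

/-- Passage between blocks of universal quantifiers, the variables of the first block being
replaced by values of variables after the second. -/
theorem Valid.reindex (hW : W.IsBasicModel) {A B A' B' : Formula} (xs ys : List ℕ) (θ : ℕ → ℕ)
    (hA : ∀ (M : Set ℕ) (f : Evaluation M) (σ : ℕ → M) (b : Fin ys.length → M) (t : ℕ),
      Realizes W f A' (assign σ ys b) t →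
      Realizes W f A (assign σ xs fun i => assign σ ys b (θ (xs.get i))) t)
    (hB : ∀ (M : Set ℕ) (f : Evaluation M) (σ : ℕ → M) (b : Fin ys.length → M) (t : ℕ),
      Realizes W f B (assign σ xs fun i => assign σ ys b (θ (xs.get i))) t →
      Realizes W f B' (assign σ ys b) t) :
    Valid W (allImp xs A B) (allImp ys A' B') := by
  choose l hl hlv using exists_lookup hW ys
  have hF := Idx.subst hW (n := ys.length + 1) (k := xs.length + 1) (by omega)
    (D := fun ρ => ρ 0 ∈ W.I (xs.length + 1))
    (Idx.of_index (Comp.var hW 0) fun ρ h => h)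
    (h := fun i ρ x => if h : i < xs.length then l (θ (xs.get ⟨i, h⟩)) ρ x else x ys.length) (by
      intro i _
      by_cases h : i < xs.length
      · simpa only [h, dite_true] using hl _ _
      · simpa only [h, dite_false] using Idx.var hW (Nat.lt_succ_self _))
  refine Valid.of_idx hF fun M f σ s hs => ?_
  rw [realizes_allImp] at hs
  refine ⟨hs.1, fun t b ht => ?_⟩
  obtain ⟨r, hr, hBr⟩ := hs.2 t _ (hA M f σ b t ht)
  refine ⟨r, ?_, hB M f σ b r hBr⟩
  rw [← initial_snocSeq] at hr
  convert hr using 3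
  · rfl
  funext i
  by_cases h : i < xs.length <;> simp [h, hlv, snocSeq]

theorem Valid.allImp_subst (hW : W.IsBasicModel) {A B : Formula} (xs : List ℕ) (θ : ℕ → ℕ)
    (hθ : ∀ y, y ∉ xs → θ y = y) (hA : A.FreeFor θ) (hB : B.FreeFor θ) :
    Valid W (allImp xs A B) (allImp xs (A.subst θ) (B.subst θ)) := by
  have key : ∀ (M : Set ℕ) (σ : ℕ → M) (b : Fin xs.length → M),
      (assign σ xs fun i => assign σ xs b (θ (xs.get i))) = assign σ xs b ∘ θ := by
    intro M σ b
    funext y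
    by_cases hy : y ∈ xs
    · exact assign_values σ (assign σ xs b ∘ θ) hy
    · rw [assign_of_notMem _ _ hy, Function.comp_apply, hθ y hy, assign_of_notMem _ _ hy]
  refine Valid.reindex hW xs xs θ ?_ ?_
  · intro M f σ b t ht
    rwa [key, ← realizes_subst A hA]
  · intro M f σ b t ht
    rwa [key, ← realizes_subst B hB] at ht

/-- The old block receives the current values of its variables; a relevant variable outside `xs` is
not in `ys` and keeps its outer value. -/
theorem Valid.allImp_change (hW : W.IsBasicModel) {A B : Formula} (xs ys : List ℕ)
    (h : ∀ y ∈ ys, y ∉ (allImp xs A B).fv) : Valid W (allImp xs A B) (allImp ys A B) := by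
  have key : ∀ (M : Set ℕ) (σ : ℕ → M) (b : Fin ys.length → M) (y : ℕ), y ∈ A.fv ∨ y ∈ B.fv →
      assign σ xs (fun i => assign σ ys b (xs.get i)) y = assign σ ys b y := by
    intro M σ b y hy
    by_cases hx : y ∈ xs
    · exact assign_values σ (assign σ ys b) hx
    · rw [assign_of_notMem _ _ hx, assign_of_notMem]
      exact fun hys => h y hys (mem_fv_allImp.2 ⟨hx, hy⟩)
  refine Valid.reindex hW xs ys id ?_ ?_
  · intro M f σ b t ht
    exact realizes_congr A (fun y hy => (key M σ b y (.inl hy)).symm) ht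
  · intro M f σ b t ht
    exact realizes_congr B (fun y hy => key M σ b y (.inr hy)) ht

theorem update_snocSeq {M : Set ℕ} {n : ℕ} (b : Fin n → M) (t q : ℕ) :
    (fun i => if i < n then snocSeq b t i else q) = snocSeq b q := by
  funext i
  by_cases h : i < n <;> simp [snocSeq, h]

theorem snocSeq_self {M : Set ℕ} {n : ℕ} (b : Fin n → M) (t : ℕ) : snocSeq b t n = t := by
  simp [snocSeq]

/-- With `e₁`, `e₂` the components of the realizer, the new function is `φ_{e₂}(b, φ_{e₁}(b, t))`.
-/
theorem Valid.allImp_trans (hW : W.IsBasicModel) {A B C : Formula} (xs : List ℕ) :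
    Valid W (conj (allImp xs A B) (allImp xs B C)) (allImp xs A C) := by
  have hF := Idx.comp hW (n := xs.length + 1) (k := xs.length + 1) (by omega)
    (D := fun ρ => W.p₁ (ρ 0) ∈ W.I (xs.length + 1) ∧ W.p₂ (ρ 0) ∈ W.I (xs.length + 1))
    (Idx.of_index ((Comp.var hW 0).snd_eq hW) fun ρ h => h.2)
    (H := fun i ρ x r => if i < xs.length then r = x i else
      r ∈ W.φ (xs.length + 1) (W.p₁ (ρ 0)) (initial (xs.length + 1) x)) (by
      intro i _
      by_cases h : i < xs.length
      · simpa only [h, if_true] using Idx.var hW (h.trans (Nat.lt_succ_self _))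
      · simpa only [h, if_false] using
          Idx.of_index ((Comp.var hW 0).fst_eq hW) fun ρ h => h.1)
  refine Valid.of_idx hF fun M f σ s hs => ?_
  rw [realizes_conj, realizes_allImp, realizes_allImp] at hs
  refine ⟨⟨hs.1.1, hs.2.1⟩, fun t b ht => ?_⟩
  obtain ⟨q, hq, hB⟩ := hs.1.2 t b ht
  obtain ⟨r, hr, hC⟩ := hs.2.2 q b hB
  rw [← initial_snocSeq] at hq hr
  refine ⟨r, ⟨snocSeq b q, fun i _ => ?_, hr⟩, hC⟩
  by_cases hi : i < xs.length
  · simp [hi, snocSeq]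
  · simpa [hi, snocSeq] using hq

theorem Valid.allImp_conj (hW : W.IsBasicModel) {A B C : Formula} (xs : List ℕ) :
    Valid W (conj (allImp xs A B) (allImp xs A C)) (allImp xs A (conj B C)) := by
  have hF := Idx.pair hW (n := xs.length + 1)
    (D := fun ρ => W.p₁ (ρ 0) ∈ W.I (xs.length + 1) ∧ W.p₂ (ρ 0) ∈ W.I (xs.length + 1))
    (Idx.of_index ((Comp.var hW 0).fst_eq hW) fun ρ h => h.1)
    (Idx.of_index ((Comp.var hW 0).snd_eq hW) fun ρ h => h.2)
  refine Valid.of_idx hF fun M f σ s hs => ?_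
  rw [realizes_conj, realizes_allImp, realizes_allImp] at hs
  refine ⟨⟨hs.1.1, hs.2.1⟩, fun t b ht => ?_⟩
  obtain ⟨q, hq, hB⟩ := hs.1.2 t b ht
  obtain ⟨r, hr, hC⟩ := hs.2.2 t b ht
  rw [← initial_snocSeq] at hq hr
  exact ⟨_, ⟨q, r, hq, hr, rfl⟩, realizes_conj.2 (by simpa using ⟨hB, hC⟩)⟩

/-- The tag `p₁` of the last argument selects one of the two received functions, which is applied to
`p₂` of that argument. -/
theorem Valid.allImp_disj (hW : W.IsBasicModel) {A B C : Formula} (xs : List ℕ) :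
    Valid W (conj (allImp xs B A) (allImp xs C A)) (allImp xs (disj B C) A) := by
  have hlast : ∀ D, W.Idx (xs.length + 1) D (fun _ x r => r = x xs.length) :=
    fun D => Idx.var hW (Nat.lt_succ_self _)
  have hsub : ∀ D, ∀ i < xs.length + 1, W.Idx (xs.length + 1) D
      (fun _ x r => r = if i < xs.length then x i else W.p₂ (x xs.length)) := by
    intro D i _
    by_cases h : i < xs.length
    · simpa only [h, if_true] using Idx.var hW (h.trans (Nat.lt_succ_self _))
    · simpa only [h, if_false] using (hlast D).snd_eq hW
  have hF := Idx.cases hW (n := xs.length + 1)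
    (D := fun ρ => W.p₁ (ρ 0) ∈ W.I (xs.length + 1) ∧ W.p₂ (ρ 0) ∈ W.I (xs.length + 1))
    (Idx.subst hW (by omega)
      (Idx.of_index ((Comp.var hW 0).fst_eq hW) fun ρ h => h.1) (hsub _))
    (Idx.subst hW (by omega)
      (Idx.of_index ((Comp.var hW 0).snd_eq hW) fun ρ h => h.2) (hsub _))
    ((hlast _).fst_eq hW)
  refine Valid.of_idx hF fun M f σ s hs => ?_
  rw [realizes_conj, realizes_allImp, realizes_allImp] at hs
  refine ⟨⟨hs.1.1, hs.2.1⟩, fun t b ht => ?_⟩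
  simp only [snocSeq_self, update_snocSeq, initial_snocSeq]
  rcases realizes_disj.1 ht with ⟨h0, ht⟩ | ⟨h1, ht⟩
  · obtain ⟨r, hr, hA⟩ := hs.1.2 _ b ht
    exact ⟨r, .inl ⟨h0, hr⟩, hA⟩
  · obtain ⟨r, hr, hA⟩ := hs.2.2 _ b ht
    exact ⟨r, .inr ⟨by omega, hr⟩, hA⟩

/-- The last argument codes a witness and a realizer; unpacking it supplies the two last arguments
of the received function. -/
theorem Valid.allImp_ex (hW : W.IsBasicModel) {A B : Formula} (xs : List ℕ) (x : ℕ)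
    (hx : x ∉ A.fv) : Valid W (allImp (xs ++ [x]) B A) (allImp xs (ex x B) A) := by
  have hlast : ∀ D, W.Idx (xs.length + 1) D (fun _ x r => r = x xs.length) :=
    fun D => Idx.var hW (Nat.lt_succ_self _)
  have hF := Idx.subst hW (n := xs.length + 1) (k := (xs ++ [x]).length + 1) (by omega)
    (D := fun ρ => ρ 0 ∈ W.I ((xs ++ [x]).length + 1))
    (Idx.of_index (Comp.var hW 0) fun ρ h => h)
    (h := fun i _ x => if i < xs.length then x i else if i = xs.length then
      W.p₁ (x xs.length) else W.p₂ (x xs.length)) (by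
      intro i _
      by_cases h : i < xs.length
      · simpa only [h, if_true] using Idx.var hW (h.trans (Nat.lt_succ_self _))
      · by_cases h' : i = xs.length
        · simpa only [h, h', if_true, if_false, lt_irrefl] using (hlast _).fst_eq hW
        · simpa only [h, h', if_false] using (hlast _).snd_eq hW)
  refine Valid.of_idx hF fun M f σ s hs => ?_
  rw [realizes_allImp] at hs
  refine ⟨hs.1, fun t b ht => ?_⟩
  obtain ⟨hm, ht⟩ := realizes_ex.1 ht
  let a : Fin (xs ++ [x]).length → M :=
    fun i => if h : i.1 < xs.length then b ⟨i, h⟩ else ⟨W.p₁ t, hm⟩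
  have ha : assign σ (xs ++ [x]) a = Function.update (assign σ xs b) x ⟨W.p₁ t, hm⟩ := by
    rw [assign_append_singleton]
    simp [a]
  obtain ⟨r, hr, hA⟩ := hs.2 (W.p₂ t) a (ha ▸ ht)
  refine ⟨r, ?_, realizes_congr A (fun y hy => ?_) hA⟩
  · rw [← initial_snocSeq] at hr
    convert hr using 3
    · rfl
    funext i
    by_cases h : i < xs.length
    · have : i < xs.length + 1 := by omega
      simp [snocSeq, h, a, this]
    · by_cases h' : i = xs.length
      · simp [snocSeq, h', a]
      · have : ¬ i < xs.length + 1 := by omega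
        simp [snocSeq, h, h', this]
  · rw [ha, Function.update_of_ne]
    rintro rfl
    exact hx hy

/-- Currying: the realizer `s` of `A` and the variables outside `xs` are frozen as constants, and
the function for the premise is applied to the pair of `s` and `t`. -/
theorem Valid.to_allImp (hW : W.IsBasicModel) {A B C : Formula} (xs : List ℕ)
    (hxs : ∀ x ∈ xs, x ∉ A.fv) (hV : Valid W (conj A B) C) : Valid W A (allImp xs B C) := by
  obtain ⟨G, ⟨n, hn, hG⟩, H⟩ := hV
  choose l hl hlv using exists_lookup hW xs
  have hF := Idx.subst hW (n := xs.length + 1) (D := fun _ => True) hn (Idx.of_compAt hW hG)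
    (h := fun i ρ x => i.casesOn (W.c (ρ 0, x xs.length)) fun y => l y ρ x) (by
      rintro (_ | i) _
      · exact Idx.pair_eq hW (Idx.param hW (by omega) (Comp.var hW 0))
          (Idx.var hW (Nat.lt_succ_self _))
      · exact hl i _)
  refine Valid.of_idx hF fun M f σ s hs => ⟨trivial, fun t b ht => ?_⟩
  obtain ⟨r, hr, hC⟩ := H M f (assign σ xs b) (W.c (s, t)) (by
    rw [realizes_conj, p₁_c, p₂_c]
    exact ⟨realizes_congr A (fun y hy => (assign_of_notMem _ _ fun h => hxs y h hy).symm) hs, ht⟩)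
  refine ⟨r, ?_, hC⟩
  convert hr using 2 with i
  cases i with
  | zero => simp [env, snocSeq_self]
  | succ y => simp [env, hlv]

theorem Valid.trans (hW : W.IsBasicModel) {A B C : Formula} (h₁ : Valid W A B)
    (h₂ : Valid W B C) : Valid W A C := by
  obtain ⟨F, hF, H₁⟩ := h₁
  obtain ⟨G, hG, H₂⟩ := h₂
  refine ⟨_, Comp.bind hW hG (H := fun i => i.casesOn F fun y x r => r = x (y + 1)) ?_, ?_⟩
  · rintro (_ | i)
    · exact hF
    · exact Comp.var hW _
  · intro M f σ s hs
    obtain ⟨q, hq, hB⟩ := H₁ M f σ s hs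
    obtain ⟨r, hr, hC⟩ := H₂ M f σ q hB
    refine ⟨r, ⟨env σ q, ?_, hr⟩, hC⟩
    rintro (_ | i)
    · exact hq
    · rfl

theorem Valid.conj (hW : W.IsBasicModel) {A B C : Formula} (h₁ : Valid W A B)
    (h₂ : Valid W A C) : Valid W A (conj B C) := by
  obtain ⟨F, hF, H₁⟩ := h₁
  obtain ⟨G, hG, H₂⟩ := h₂
  refine ⟨_, hF.pair hW hG, fun M f σ s hs => ?_⟩
  obtain ⟨q, hq, hB⟩ := H₁ M f σ s hs
  obtain ⟨r, hr, hC⟩ := H₂ M f σ s hs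
  exact ⟨_, ⟨q, r, hq, hr, rfl⟩, realizes_conj.2 (by simpa using ⟨hB, hC⟩)⟩

theorem Valid.disj (hW : W.IsBasicModel) {A B C : Formula} (h₁ : Valid W B A)
    (h₂ : Valid W C A) : Valid W (disj B C) A := by
  obtain ⟨F, hF, H₁⟩ := h₁
  obtain ⟨G, hG, H₂⟩ := h₂
  have hv : ∀ i : ℕ, W.Comp fun x r => r = (i.casesOn (W.p₂ (x 0)) fun y => x (y + 1) : ℕ) := by
    rintro (_ | i)
    · exact (Comp.var hW 0).snd_eq hW
    · exact Comp.var hW _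
  have he : ∀ (M : Set ℕ) (σ : ℕ → M) (s : ℕ),
      (fun i : ℕ => (i.casesOn (W.p₂ (env σ s 0)) fun y => env σ s (y + 1) : ℕ)) =
        env σ (W.p₂ s) := by
    intro M σ s
    funext i
    cases i <;> rfl
  refine ⟨_, Comp.cases hW (hF.subst hW hv) (hG.subst hW hv) ((Comp.var hW 0).fst_eq hW),
    fun M f σ s hs => ?_⟩
  rcases realizes_disj.1 hs with ⟨h0, hs⟩ | ⟨h1, hs⟩
  · obtain ⟨r, hr, hA⟩ := H₁ M f σ _ hs
    exact ⟨r, .inl ⟨h0, (he M σ s).symm ▸ hr⟩, hA⟩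
  · obtain ⟨r, hr, hA⟩ := H₂ M f σ _ hs
    refine ⟨r, .inr ⟨?_, (he M σ s).symm ▸ hr⟩, hA⟩
    change W.p₁ s ≠ 0
    omega

/-! ### Soundness of BQC -/

theorem BQC.valid (hW : W.IsBasicModel) {A B : Formula} (h : BQC A B) : Valid W A B := by
  have c0 := Comp.var hW 0
  have f0 := c0.fst_eq hW
  have s0 := c0.snd_eq hW
  induction h with
  | a1 => exact Valid.of_fun c0 fun M f σ s hs => hs
  | a2 => exact Valid.of_fun c0 fun M f σ s hs => by rw [Realizes]; trivial
  | a3 => exact Valid.of_fun c0 fun M f σ s hs => by simp [Realizes] at hs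
  | a4 x _ _ hx =>
    -- Re-bracketing `(a, (m, b))` to `(m, (a, b))`; the next axiom uses the same map, with a
    -- disjunction tag in place of the witness `m`.
    refine Valid.of_fun ((s0.fst_eq hW).pair_eq hW (f0.pair_eq hW (s0.snd_eq hW)))
      fun M f σ s hs => ?_
    obtain ⟨hA, hB⟩ := realizes_conj.1 hs
    obtain ⟨hm, hB⟩ := realizes_ex.1 hB
    refine realizes_ex.2 ⟨by simpa using hm, ?_⟩
    simp only [p₁_c, p₂_c, realizes_conj]
    refine ⟨realizes_congr _ (fun y hy => ?_) hA, hB⟩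
    rw [Function.update_of_ne]
    rintro rfl
    exact hx hy
  | a5 =>
    refine Valid.of_fun ((s0.fst_eq hW).pair_eq hW (f0.pair_eq hW (s0.snd_eq hW)))
      fun M f σ s hs => ?_
    obtain ⟨hA, hB⟩ := realizes_conj.1 hs
    rw [realizes_disj] at hB ⊢
    simp only [p₁_c, p₂_c, realizes_conj]
    exact hB.imp (fun h => ⟨h.1, hA, h.2⟩) fun h => ⟨h.1, hA, h.2⟩
  | a6 xs => exact Valid.allImp_trans hW xs
  | a7 xs => exact Valid.allImp_conj hW xs
  | a8 xs => exact Valid.allImp_disj hW xs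
  | a9 xs θ _ _ hθ hA hB => exact Valid.allImp_subst hW xs θ hθ hA hB
  | a10 xs ys _ _ h => exact Valid.allImp_change hW xs ys h
  | a11 xs x _ _ h => exact Valid.allImp_ex hW xs x h
  | r1 _ _ h₁ h₂ => exact h₁.trans hW h₂
  | r2 _ _ h₁ h₂ => exact h₁.conj hW h₂
  | r3l _ h =>
    exact h.trans hW (Valid.of_fun f0 fun M f σ s hs => (realizes_conj.1 hs).1)
  | r3r _ h =>
    exact h.trans hW (Valid.of_fun s0 fun M f σ s hs => (realizes_conj.1 hs).2)
  | r4 _ _ h₁ h₂ => exact h₁.disj hW h₂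
  | r5l _ h =>
    exact (Valid.of_fun ((Comp.const hW 0).pair_eq hW c0) fun M f σ s hs =>
      realizes_disj.2 (.inl (by simpa using hs))).trans hW h
  | r5r _ h =>
    exact (Valid.of_fun ((Comp.const hW 1).pair_eq hW c0) fun M f σ s hs =>
      realizes_disj.2 (.inr (by simpa using hs))).trans hW h
  | r6 x t hA hB _ h =>
    refine h.subst hW (fun i ρ => i.casesOn (ρ 0) fun y => ρ (single t x y + 1)) ?_ ?_
    · rintro (_ | i)
      · exact c0
      · exact Comp.var hW _
    · intro M f σ s hs
      refine ⟨σ ∘ single t x, s, ?_, (realizes_subst _ hA).1 hs,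
        fun r hr => (realizes_subst _ hB).2 hr⟩
      rintro (_ | i) <;> rfl
  | r7 x hx _ h =>
    refine h.subst hW (fun i ρ => i.casesOn (W.p₂ (ρ 0))
      fun y => if y = x then W.p₁ (ρ 0) else ρ (y + 1)) ?_ ?_
    · rintro (_ | i)
      · exact s0
      · by_cases hi : i = x
        · simpa only [hi, if_true] using f0
        · simpa only [hi, if_false] using Comp.var hW _
    · intro M f σ s hs
      obtain ⟨hm, hs⟩ := realizes_ex.1 hs
      refine ⟨_, _, ?_, hs, fun r => realizes_congr _ fun y hy => ?_⟩
      · rintro (_ | i)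
        · rfl
        · by_cases hi : i = x <;> simp [hi, env]
      · rw [Function.update_of_ne]
        rintro rfl
        exact hx hy
  | r8 x _ _ h =>
    -- The current value of `x` is its own witness; it sits at entry `x + 1`, since entry `0` holds
    -- the realizer.
    refine (Valid.of_fun ((Comp.var hW (x + 1)).pair_eq hW c0) fun M f σ s hs => ?_).trans hW h
    refine realizes_ex.2 ⟨by simp [env], ?_⟩
    simpa [env] using hs
  | r9 xs hxs _ h => exact h.to_allImp hW xs hxs

theorem bqcSound (hW : W.IsBasicModel) : BQCSound W := by
  intro A B zs hne _ hfv hAB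
  obtain ⟨G, ⟨n, hn, hG⟩, H⟩ := hAB.valid hW
  have hlen : 0 < zs.length := List.length_pos_iff.2 hne
  have hi : ∀ y, ∃ i : Fin zs.length, y ∈ zs →
      ∀ (M : Set ℕ) (σ : ℕ → M) (a : Fin zs.length → M), assign σ zs a y = a i := by
    intro y
    by_cases hy : y ∈ zs
    · obtain ⟨i, -, hi⟩ := exists_assign_eq hy
      exact ⟨i, fun _ => hi⟩
    -- The derivation may pass through variables outside `zs`, and they need values in `M`. As the
    -- realizer must not depend on `M`, no fixed number will do; the value of the first variable of
    -- `zs` serves, whence the nonempty list.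
    · exact ⟨⟨0, hlen⟩, fun h => absurd h hy⟩
  choose l hl using hi
  have hF := Idx.subst hW (n := zs.length + 1) (D := fun _ => True) hn (Idx.of_compAt hW hG)
    (h := fun i _ x => i.casesOn (x zs.length) fun y => x (l y)) (by
      rintro (_ | i) _
      · exact Idx.var hW (Nat.lt_succ_self _)
      · exact Idx.var hW ((l i).2.trans (Nat.lt_succ_self _)))
  obtain ⟨g, hg, hgG⟩ := hF.compAt (ρ := id) trivial
  obtain ⟨e, he, rfl⟩ := exists_index hg
  refine ⟨e, fun M _ f σ => realizes_allImp.2 ⟨he, fun s a hs => ?_⟩⟩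
  have key : ∀ y, y ∈ A.fv ∪ B.fv → assign σ zs a y = a (l y) :=
    fun y hy => hl y (List.mem_toFinset.1 (hfv hy)) M σ a
  obtain ⟨r, hr, hB⟩ := H M f (fun y => a (l y)) s
    (realizes_congr A (fun y hy => key y (Finset.mem_union_left _ hy)) hs)
  refine ⟨r, ?_, realizes_congr B (fun y hy => (key y (Finset.mem_union_right _ hy)).symm) hB⟩
  rw [← initial_snocSeq]
  refine hgG _ _ ?_
  convert hr using 2 with i
  cases i with
  | zero => simp [env, snocSeq_self]
  | succ y => simp [env, snocSeq]

/-! ### Modus ponens and the failure of IPC -/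

theorem ipc_modusPonens (P Q : Formula) : IPC (imp (conj P (imp P Q)) Q) :=
  .r1 (.a5 P (imp P Q)) (.r1 (.a6 P (imp P Q)) (.a3 _ P Q))

theorem not_ipcSound (hW : W.IsBasicModel) (hU : ¬ ∃ u ∈ W.V 2, W.Overuniversal 1 u) :
    ¬ IPCSound W := by
  intro h
  let P : Formula := atom 0 0 ![]
  let Q : Formula := atom 0 1 ![]
  obtain ⟨e, he⟩ := h _ [0] (by simp) (by simp) (by simp [P, Q, fv]) (ipc_modusPonens P Q)
  have he' : ∀ f : Evaluation Set.univ, Realizes W f (allImp [0] (conj P (imp P Q)) Q)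
      (fun _ => ⟨0, trivial⟩) e := fun f => he _ Set.univ_nonempty f _
  have heI := (realizes_allImp.1 (he' fun _ _ _ => ∅)).1
  -- The candidate is `u(i, a) = φ_e(i, c(a, i))`. The first argument of `φ_e` is the value of the
  -- vacuous variable; any number would do, and `i` is at hand.
  have hc : W.CompAt 2 (fun x r => r ∈ W.φ 2 e ![x 0, W.c (x 1, x 0)]) := by
    have hF := Idx.subst hW (n := 2) (k := 2) (D := fun _ => True) (by omega)
      (Idx.of_compAt hW ⟨_, φ_mem heI, fun x r h => h⟩)
      (h := fun i _ x => if i = 0 then x 0 else W.c (x 1, x 0)) (by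
        intro i _
        by_cases hi : i = 0
        · simpa only [hi, if_true] using Idx.var hW (by omega)
        · simpa only [hi, if_false] using
            Idx.pair_eq hW (Idx.var hW (by omega)) (Idx.var hW (by omega)))
    refine (hF.compAt (ρ := id) trivial).mono fun x r hr => ?_
    convert hr using 2
    funext i
    fin_cases i <;> rfl
  obtain ⟨u, hu, hur⟩ := hc
  refine hU ⟨u, hu, fun i hi a k hk => ?_⟩
  have ha : ![a 0] = a := by funext j; fin_cases j; rfl
  -- Singletons: the only realizer of `P` is the argument, so `i` has to be defined there alone, and
  -- the only realizer of `Q` is `k`, which pins down the output of `e`.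
  let f : Evaluation Set.univ := fun _ i _ => if i = 0 then {a 0} else {k}
  obtain ⟨-, H⟩ := realizes_allImp.1 (he' f)
  obtain ⟨r, hr, hQ⟩ := H (W.c (a 0, i)) (fun _ => ⟨i, trivial⟩) (by
    rw [realizes_conj, p₁_c, p₂_c]
    refine ⟨by simp [P, Realizes, f], ?_⟩
    rw [Realizes]
    refine ⟨hi, fun s hs => ⟨k, ?_, by simp [Q, Realizes, f]⟩⟩
    have : s = a 0 := by simpa [P, Realizes, f] using hs
    rwa [this, ha])
  obtain rfl : r = k := by simpa [Q, Realizes, f] using hQ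
  have hsnoc : Fin.snoc (α := fun _ : Fin 2 => ℕ) (fun _ : Fin 1 => i) (W.c (a 0, i)) =
      ![i, W.c (a 0, i)] := by
    funext j
    fin_cases j <;> rfl
  have hr' : r ∈ W.φ 2 e ![i, W.c (a 0, i)] := hsnoc ▸ hr
  have := hur (fun j => if j = 0 then i else a 0) r hr'
  convert this using 2
  funext j
  fin_cases j <;> rfl

end VReal

theorem mainTheorem4 (W : VReal.NumberedFunctions) (hW : W.IsBasicModel)
    (hU : ¬ ∃ u ∈ W.V 2, W.Overuniversal 1 u) :
    VReal.BQCSound W ∧ ¬ VReal.IPCSound W :=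
  ⟨VReal.bqcSound hW, VReal.not_ipcSound hW hU⟩
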